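/- **Setting.** Let $n\ge 2$ and let $\mathbb{H}^n=\{x\in\mathbb{R}^{n+1}: x_0^2-x_1^2-\dots-x_n^2=1,\ x_0>0\}$ be the hyperbolic space, with vertex $v=(1,0,\dots,0)$, geodesic distance $d(x,y)=\cosh^{-1}(x_0y_0-x_1y_1-\dots-x_ny_n)$, geodesic balls $B_R(x)=\{y: d(x,y)<R\}$, Riemannian volume $\mathrm{d}x=\sinh^{n-1}\theta\,\mathrm{d}\theta\,\mathrm{d}\sigma_\xi$ in polar coordinates $x=(\cosh\theta,\sinh\theta\,\xi)$, $\xi\in\mathbb{S}^{n-1}$, and Laplace–Beltrami operator $\Delta$. Let $G(x,y)=\Phi(d(x,y))$ be the Green's function of $-\Delta$ on $\mathbb{H}^n$, where $$\Phi(\theta)=-\frac1{2\pi}\log\Bigl(\tanh\frac\theta2\Bigr)\ \ (n=2),\qquad \Phi(\theta)=\frac1{n\alpha(n)}\int_\theta^\infty\frac{\mathrm{d}\zeta}{\sinh^{n-1}\zeta}\ \ (n\ge3),$$ and $\alpha(n)$ is the volume of the unit ball of $\mathbb{R}^n$. Let $A:[0,\infty)\to\mathbb{R}$ be continuous on $[0,\infty)$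 and $C^2$ on $(0,\infty)$, and let $K(x,y)=G(x,y)+A(d(x,y))$. For a probability density $\rho\in L^1(\mathbb{H}^n,\mathrm{d}x)$, let $\mathrm{supp}(\rho)$ be the support of the measure $\rho(x)\,\mathrm{d}x$, and put $$\Lambda(x)=\int_{\mathbb{H}^n}K(x,y)\rho(y)\,\mathrm{d}y,\qquad E[\rho]=\frac12\iint_{\mathbb{H}^n\times\mathbb{H}^n}K(x,y)\rho(x)\rho(y)\,\mathrm{d}x\,\mathrm{d}y .$$ The density $\rho$ is called an *equilibrium solution* of the aggregation equation $\partial_t\rho-\nabla\cdot(\rho\nabla K*\rho)=0$ if its velocity field $-\nabla\Lambda$ vanishes at every point of $\mathrm{supp}(\rho)$ (that is, $\Lambda$ is differentiable there, with zero gradient). **Proposition.** Suppose that $\Delta_xA(d(x,y))\ge 0$ for all $x\ne y$ in $\mathbb{H}^n$. Let $\rho$ be a bounded equilibrium solution that is radially symmetric about $v$ (for almost every $x$, $\rho(x)$ is a function of $d(v,x)$) and is supported in the geodesic ball $B_R(v)$ for some $R>0$ (it vanishes almost everywhere outside that ball). Then the integrals defining $\Lambda(x)$, for every $x\in\mathbb{H}^n$,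 and $E[\rho]$ converge absolutely, and $\rho$ satisfies the Euler–Lagrange necessary conditions for a local minimizer of the energy: with $\lambda=2E[\rho]$, $$\Lambda(x)=\lambda\ \text{ for a.e. } x\in\mathrm{supp}(\rho),\qquad \Lambda(x)\ge\lambda\ \text{ for a.e. } x\in\mathbb{H}^n\setminus\mathrm{supp}(\rho).$$ -/

import Mathlib

open MeasureTheory Set

noncomputable section

/-- The Lorentzian form `x₀ y₀ - x₁ y₁ - ⋯ - xₙ yₙ` on `ℝ^{n+1}`. -/
def lorentz {n : ℕ} (x y : Fin (n + 1) → ℝ) : ℝ :=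
  x 0 * y 0 - ∑ i : Fin n, x i.succ * y i.succ

/-- The hyperbolic space `ℍⁿ`: the sheet `x₀ > 0` of the hyperboloid `⟨x, x⟩ = 1` in `ℝ^{n+1}`,
with the subspace topology and its Borel sets. -/
abbrev HypSpace (n : ℕ) : Type :=
  {x : Fin (n + 1) → ℝ // lorentz x x = 1 ∧ 0 < x 0}

/-- The geodesic distance `d(x, y) = cosh⁻¹ ⟨x, y⟩`. -/
def hypDist {n : ℕ} (x y : HypSpace n) : ℝ := Real.arcosh (lorentz x.1 y.1)

/-- The open geodesic ball `B_R(x)`. -/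
def hypBall {n : ℕ} (x : HypSpace n) (R : ℝ) : Set (HypSpace n) := {y | hypDist x y < R}

theorem sum_sq_eq_norm_sq {n : ℕ} (u : EuclideanSpace ℝ (Fin n)) :
    ∑ i : Fin n, u i * u i = ‖u‖ ^ 2 := by
  rw [EuclideanSpace.real_norm_sq_eq]
  exact Finset.sum_congr rfl fun i _ => (sq (u i)).symm

/-- The global chart `u ↦ (√(1 + |u|²), u)` from `ℝⁿ` onto `ℍⁿ`. -/
def hypGraph {n : ℕ} (u : EuclideanSpace ℝ (Fin n)) : HypSpace n :=
  ⟨Fin.cons (Real.sqrt (1 + ‖u‖ ^ 2)) (fun i => u i), by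
    constructor
    · have h : (0 : ℝ) ≤ 1 + ‖u‖ ^ 2 := by positivity
      simp only [lorentz, Fin.cons_zero, Fin.cons_succ, Real.mul_self_sqrt h, sum_sq_eq_norm_sq]
      ring
    · simp only [Fin.cons_zero]
      positivity⟩

/-- The inverse of the chart: `(x₀, x₁, …, xₙ) ↦ (x₁, …, xₙ)`. -/
def hypCoord {n : ℕ} (x : HypSpace n) : EuclideanSpace ℝ (Fin n) :=
  WithLp.toLp 2 (fun i => x.1 i.succ)

theorem hypCoord_hypGraph {n : ℕ} (u : EuclideanSpace ℝ (Fin n)) :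
    hypCoord (hypGraph u) = u := by
  ext i
  simp [hypCoord, hypGraph]

theorem hypGraph_hypCoord {n : ℕ} (x : HypSpace n) : hypGraph (hypCoord x) = x := by
  obtain ⟨x, hx, hx0⟩ := x
  apply Subtype.ext
  funext i
  refine Fin.cases ?_ (fun i => ?_) i
  · simp only [hypGraph, Fin.cons_zero]
    rw [← sum_sq_eq_norm_sq]
    simp only [lorentz] at hx
    have h : 1 + ∑ i : Fin n, x i.succ * x i.succ = x 0 ^ 2 := by linarith [sq (x 0)]
    simp only [hypCoord]
    rw [h, Real.sqrt_sq hx0.le]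
  · simp [hypGraph, hypCoord]

/-- The vertex `v = (1, 0, …, 0)`. -/
def hypVertex (n : ℕ) : HypSpace n := ⟨Pi.single 0 1, by simp [lorentz]⟩

/-- Hyperbolic polar coordinates `(θ, ξ) ↦ (cosh θ, sinh θ ξ)`, with `ξ` on the unit sphere. -/
def hypPolar {n : ℕ} (p : ℝ × Metric.sphere (0 : EuclideanSpace ℝ (Fin n)) 1) : HypSpace n :=
  ⟨Fin.cons (Real.cosh p.1) (fun i => Real.sinh p.1 * p.2.1 i), by
    constructor
    · have h : ∑ i : Fin n, p.2.1 i * p.2.1 i = 1 := by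
        rw [sum_sq_eq_norm_sq, norm_eq_of_mem_sphere, one_pow]
      have h2 : ∑ i : Fin n, (Real.sinh p.1 * p.2.1 i) * (Real.sinh p.1 * p.2.1 i)
          = Real.sinh p.1 ^ 2 := by
        calc _ = Real.sinh p.1 ^ 2 * ∑ i : Fin n, p.2.1 i * p.2.1 i := by
              rw [Finset.mul_sum]
              exact Finset.sum_congr rfl fun i _ => by ring
          _ = _ := by rw [h, mul_one]
      simp only [lorentz, Fin.cons_zero, Fin.cons_succ, h2]
      linarith [Real.cosh_sq p.1, sq (Real.cosh p.1)]
    · simpa using Real.cosh_pos p.1⟩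

/-- The canonical volume `dx = sinh^{n-1} θ dθ dσ_ξ` of `ℍⁿ`, in polar coordinates; `σ` is the
surface measure of the unit sphere of `ℝⁿ`. -/
def hypVol (n : ℕ) : Measure (HypSpace n) :=
  (((volume.restrict (Ioi (0 : ℝ))).withDensity
      (fun θ => ENNReal.ofReal (Real.sinh θ ^ (n - 1)))).prod
    (volume : Measure (EuclideanSpace ℝ (Fin n))).toSphere).map hypPolar

/-- The coordinate vector field `∂ᵢ` of the chart `hypGraph`, as a vector of `ℝ^{n+1}`. -/
def hypTangent {n : ℕ} (u : EuclideanSpace ℝ (Fin n)) (i : Fin n) : Fin (n + 1) → ℝ :=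
  Fin.cons (u i / Real.sqrt (1 + ‖u‖ ^ 2)) (Pi.single i 1)

/-- The matrix `gᵢⱼ` of the Riemannian metric of `ℍⁿ` in the chart `hypGraph`: the metric is
minus the Lorentzian form on tangent vectors. -/
def hypMetric {n : ℕ} (u : EuclideanSpace ℝ (Fin n)) : Matrix (Fin n) (Fin n) ℝ :=
  Matrix.of fun i j => -lorentz (hypTangent u i) (hypTangent u j)

theorem hypMetric_apply {n : ℕ} (u : EuclideanSpace ℝ (Fin n)) (i j : Fin n) :
    hypMetric u i j = (if i = j then 1 else 0) - u i * u j / (1 + ‖u‖ ^ 2) := by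
  have h : (0 : ℝ) ≤ 1 + ‖u‖ ^ 2 := by positivity
  have h2 : ∑ k : Fin n, (Pi.single i (1 : ℝ) : Fin n → ℝ) k * (Pi.single j (1 : ℝ) : Fin n → ℝ) k
      = if i = j then 1 else 0 := by
    simp [Pi.single_apply, eq_comm]
  simp only [hypMetric, Matrix.of_apply, lorentz, hypTangent, Fin.cons_zero, Fin.cons_succ, h2]
  rw [div_mul_div_comm, Real.mul_self_sqrt h]
  ring

theorem hypMetric_inv_apply {n : ℕ} (u : EuclideanSpace ℝ (Fin n)) (i j : Fin n) :
    (hypMetric u)⁻¹ i j = (if i = j then 1 else 0) + u i * u j := by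
  have h : (1 + ‖u‖ ^ 2 : ℝ) ≠ 0 := by positivity
  have key : hypMetric u * (Matrix.of fun i j => (if i = j then 1 else 0) + u i * u j) = 1 := by
    ext i j
    have e : ∀ k, hypMetric u i k * ((if k = j then 1 else 0) + u k * u j)
        = ((if k = j then (if i = j then 1 else 0) - u i * u j / (1 + ‖u‖ ^ 2) else 0)
          + (if i = k then u i * u j else 0))
          - u i * u j / (1 + ‖u‖ ^ 2) * (u k * u k) := by
      intro k
      rw [hypMetric_apply]
      by_cases h1 : k = j <;> by_cases h2 : i = k
      · subst h1; subst h2; simp; ring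
      · subst h1; simp [h2]; ring
      · subst h2; simp [h1]; ring
      · simp [h1, h2]; ring
    simp only [Matrix.mul_apply, Matrix.of_apply, e]
    rw [Finset.sum_sub_distrib, Finset.sum_add_distrib, ← Finset.mul_sum, sum_sq_eq_norm_sq]
    simp only [Finset.sum_ite_eq, Finset.sum_ite_eq', Finset.mem_univ, if_true, Matrix.one_apply]
    field_simp
    ring
  rw [Matrix.inv_eq_right_inv key, Matrix.of_apply]

theorem hypMetric_det {n : ℕ} (u : EuclideanSpace ℝ (Fin n)) :
    (hypMetric u).det = 1 / (1 + ‖u‖ ^ 2) := by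
  have h : (1 + ‖u‖ ^ 2 : ℝ) ≠ 0 := by positivity
  have e : hypMetric u = 1 + Matrix.replicateCol Unit (fun i => -u i / (1 + ‖u‖ ^ 2))
      * Matrix.replicateRow Unit (fun i => u i) := by
    ext i j
    rw [hypMetric_apply]
    simp [Matrix.mul_apply, Matrix.one_apply]
    ring
  rw [e, Matrix.det_one_add_replicateCol_mul_replicateRow, dotProduct]
  have e2 : ∀ k, u k * (-u k / (1 + ‖u‖ ^ 2)) = -1 / (1 + ‖u‖ ^ 2) * (u k * u k) := by
    intro k; ring
  simp only [e2]
  rw [← Finset.mul_sum, sum_sq_eq_norm_sq]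
  field_simp
  ring

/-- The `i`-th partial derivative of a function on `ℝⁿ`. -/
def partialD {n : ℕ} (i : Fin n) (F : EuclideanSpace ℝ (Fin n) → ℝ)
    (u : EuclideanSpace ℝ (Fin n)) : ℝ :=
  fderiv ℝ F u (EuclideanSpace.single i 1)

/-- The Laplace-Beltrami operator of `ℍⁿ`,
`Δ f = (det g)^{-1/2} ∑ᵢ ∂ᵢ ((det g)^{1/2} ∑ⱼ gⁱʲ ∂ⱼ f)`, in the chart `hypGraph`. -/
def laplaceBeltrami {n : ℕ} (f : HypSpace n → ℝ) (x : HypSpace n) : ℝ :=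
  (1 / Real.sqrt (hypMetric (hypCoord x)).det) *
    ∑ i : Fin n, partialD i (fun w => Real.sqrt (hypMetric w).det *
      ∑ j : Fin n, (hypMetric w)⁻¹ i j * partialD j (fun u => f (hypGraph u)) w) (hypCoord x)

/-- The volume `α(n)` of the unit ball of `ℝⁿ`. -/
def unitBallVol (n : ℕ) : ℝ :=
  (volume (Metric.ball (0 : EuclideanSpace ℝ (Fin n)) 1)).toReal

/-- The radial profile `Φ` of the Green function of `-Δ` on `ℍⁿ`. Only its values at `θ > 0`
are meaningful; the diagonal `θ = 0`, where `Φ` is infinite, has measure zero in `y` for each `x`. -/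
def greenProfile (n : ℕ) (θ : ℝ) : ℝ :=
  if n = 2 then -(1 / (2 * Real.pi)) * Real.log (Real.tanh (θ / 2))
  else 1 / (n * unitBallVol n) * ∫ ζ in Ioi θ, 1 / Real.sinh ζ ^ (n - 1)

/-- The interaction potential `K(x, y) = G(x, y) + A(d(x, y))`, with `G(x, y) = Φ(d(x, y))`. -/
def potential {n : ℕ} (A : ℝ → ℝ) (x y : HypSpace n) : ℝ :=
  greenProfile n (hypDist x y) + A (hypDist x y)

/-- The measure `ρ(x) dx`. -/
def densityMeasure {n : ℕ} (ρ : HypSpace n → ℝ) : Measure (HypSpace n) :=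
  (hypVol n).withDensity (fun x => ENNReal.ofReal (ρ x))

/-- `ρ` is the density, with respect to `dx`, of a probability measure on `ℍⁿ`. -/
structure IsProbDensity {n : ℕ} (ρ : HypSpace n → ℝ) : Prop where
  integrable : Integrable ρ (hypVol n)
  nonneg : ∀ᵐ x ∂(hypVol n), 0 ≤ ρ x
  integral_eq_one : ∫ x, ρ x ∂(hypVol n) = 1

/-- `supp(ρ)`, the support of the measure `ρ(x) dx` (a closed set). -/
def densitySupport {n : ℕ} (ρ : HypSpace n → ℝ) : Set (HypSpace n) := (densityMeasure ρ).support

/-- The interaction energy `E[μ] = ½ ∬ K(x, y) dμ(x) dμ(y)`. -/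
def interactionEnergy {n : ℕ} (K : HypSpace n → HypSpace n → ℝ) (μ : Measure (HypSpace n)) : ℝ :=
  1 / 2 * ∫ p, K p.1 p.2 ∂(μ.prod μ)

/-- `Λ(x) = (K * ρ)(x) = ∫ K(x, y) ρ(y) dy`. -/
def convPotential {n : ℕ} (K : HypSpace n → HypSpace n → ℝ) (ρ : HypSpace n → ℝ)
    (x : HypSpace n) : ℝ :=
  ∫ y, K x y * ρ y ∂(hypVol n)

/-- `ρ` is an equilibrium (steady state) of the aggregation equation `∂ₜρ = ∇ · (ρ ∇ K * ρ)`: the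
velocity field `-∇ (K * ρ)` vanishes on `supp(ρ)`. The gradient at a point is zero exactly when the
differential there, read in any chart, is zero. -/
def IsEquilibrium {n : ℕ} (K : HypSpace n → HypSpace n → ℝ) (ρ : HypSpace n → ℝ) : Prop :=
  ∀ x ∈ densitySupport ρ, HasFDerivAt (fun u => convPotential K ρ (hypGraph u))
    (0 : EuclideanSpace ℝ (Fin n) →L[ℝ] ℝ) (hypCoord x)

/-- `ρ` is radially symmetric about the vertex: `ρ(x) = f(d(v, x))` for almost every `x`. -/
def IsRadial {n : ℕ} (ρ : HypSpace n → ℝ) : Prop :=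
  ∃ f : ℝ → ℝ, Measurable f ∧ ∀ᵐ x ∂(hypVol n), ρ x = f (hypDist (hypVertex n) x)

end

/-! Since ρ is radial, Λ(x) = L(θ) with θ = d(v, x), and everything reduces to the function L of one
variable. Let S be the compact set of distances from v to points of supp ρ. The equilibrium
condition gives L' = 0 at the positive points of S. Over an interval of radii that misses S, Λ is
subharmonic, because G is harmonic off the diagonal and A contributes a nonnegative Laplacian. For a
radial function this means that the flux sinh^{n-1}θ · L' increases, in other words that L is a
convex function of −Φ(θ). Convexity is used as the three-point inequality (L y − L x)(Φ y − Φ z) ≤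
(L z − L y)(Φ x − Φ y) for x < y < z, which needs no derivative of L.

On a gap (a, b) of S with a > 0, a convex function with zero slope at both ends is constant. On the
gap that starts at 0, L is increasing, and the zero slope at b gives the opposite inequality. So L'
= 0 on all of (0, max S] and L equals a constant l there; beyond max S, convexity and the zero slope
at max S give L ≥ l. This is `exists_const_of_gaps`. Integrating Λ = l against ρ identifies l with
2E[ρ].

Two facts about spherical means feed this argument. Newton's theorem `sphereMean_eq` turns the Green
part into an integral of Φ(max θ r). For A, `sphereMean_slope_le` gives convexity in −Φ although A
is only continuous at distance 0: with w = cosh d and B = A ∘ arcosh, continuity at w = 1 forces B'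
≥ 0, hence the translates B(w + ε), smooth up to w = 1, are again subharmonic, and ε tends to 0.
Both rest on `hasDerivAt_sphereMean_flux`, an integration by parts on the sphere obtained from
rotation invariance. -/

/-- Differentiation under the integral sign over a compact space. -/
theorem hasDerivAt_integral_of_compact {X : Type*} [TopologicalSpace X] [CompactSpace X]
    [MeasurableSpace X] [OpensMeasurableSpace X] (μ : Measure X) [IsFiniteMeasure μ]
    {F F' : ℝ → X → ℝ} {I : Set ℝ} (hI : IsOpen I)
    (hF : ∀ θ ∈ I, Continuous (F θ)) (hF' : ContinuousOn (Function.uncurry F') (I ×ˢ univ))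
    (hd : ∀ θ ∈ I, ∀ x, HasDerivAt (fun τ => F τ x) (F' θ x) θ) {θ : ℝ} (hθ : θ ∈ I) :
    HasDerivAt (fun τ => ∫ x, F τ x ∂μ) (∫ x, F' θ x ∂μ) θ := by
  obtain ⟨δ, hδ, hb⟩ := Metric.nhds_basis_closedBall.mem_iff.1 (hI.mem_nhds hθ)
  have hK : IsCompact (Metric.closedBall θ δ ×ˢ (univ : Set X)) :=
    (isCompact_closedBall θ δ).prod isCompact_univ
  obtain ⟨C, hC⟩ := hK.exists_bound_of_continuousOn (hF'.mono (prod_mono hb subset_rfl))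
  have hF'c : Continuous (F' θ) := by
    have : ContinuousOn (fun x => Function.uncurry F' (θ, x)) univ :=
      hF'.comp (by fun_prop) (fun x _ => ⟨hθ, mem_univ _⟩)
    simpa [continuousOn_univ] using this
  refine (hasDerivAt_integral_of_dominated_loc_of_deriv_le (bound := fun _ => C)
    (Metric.closedBall_mem_nhds θ hδ) ?_ ?_ ?_ ?_ (integrable_const _) ?_).2
  · filter_upwards [hI.mem_nhds hθ] with τ hτ using (hF τ hτ).aestronglyMeasurable
  · exact (hF θ hθ).integrable_of_hasCompactSupport (HasCompactSupport.of_compactSpace _)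
  · exact hF'c.aestronglyMeasurable
  · exact Filter.Eventually.of_forall fun x τ hτ => hC (τ, x) ⟨hτ, mem_univ _⟩
  · exact Filter.Eventually.of_forall fun x τ hτ => hd τ (hb hτ) x

/-! ### Rotation invariance and integration by parts on the unit sphere. -/

section Sphere


open scoped RealInnerProductSpace Pointwise

variable {E : Type*} [NormedAddCommGroup E] [InnerProductSpace ℝ E]

/-- The homeomorphism of the unit sphere induced by a linear isometry. -/
def sphereHomeomorph (e : E ≃ₗᵢ[ℝ] E) :
    Metric.sphere (0 : E) 1 ≃ₜ Metric.sphere (0 : E) 1 where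
  toFun ξ := ⟨e ξ, by simp⟩
  invFun ξ := ⟨e.symm ξ, by simp⟩
  left_inv ξ := by ext; simp
  right_inv ξ := by ext; simp
  continuous_toFun := by fun_prop
  continuous_invFun := by fun_prop

theorem inner_mem_Icc_of_sphere {u : E} (hu : ‖u‖ = 1) (ξ : Metric.sphere (0 : E) 1) :
    ⟪u, (ξ : E)⟫ ∈ Icc (-1 : ℝ) 1 := by
  have h := abs_real_inner_le_norm u (ξ : E)
  rw [hu, norm_eq_of_mem_sphere, one_mul] at h
  exact abs_le.1 h

variable [FiniteDimensional ℝ E]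

/-- The rotation by the angle `t` in the plane of two orthonormal vectors. -/
theorem exists_rotation {u e : E} (hu : ‖u‖ = 1) (he : ‖e‖ = 1) (hue : ⟪u, e⟫ = 0) (t : ℝ) :
    ∃ Rt : E ≃ₗᵢ[ℝ] E, ∀ x, ⟪u, Rt x⟫ = Real.cos t * ⟪u, x⟫ - Real.sin t * ⟪e, x⟫ ∧
      ⟪e, Rt x⟫ = Real.sin t * ⟪u, x⟫ + Real.cos t * ⟪e, x⟫ := by
  have huu : ⟪u, u⟫ = 1 := by rw [real_inner_self_eq_norm_sq, hu]; norm_num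
  have hee : ⟪e, e⟫ = 1 := by rw [real_inner_self_eq_norm_sq, he]; norm_num
  have heu : ⟪e, u⟫ = 0 := by rw [real_inner_comm, hue]
  let f : E →ₗ[ℝ] E := LinearMap.id
    + ((Real.cos t - 1) • (innerₛₗ ℝ u) - Real.sin t • (innerₛₗ ℝ e)).smulRight u
    + (Real.sin t • (innerₛₗ ℝ u) + (Real.cos t - 1) • (innerₛₗ ℝ e)).smulRight e
  have hf : ∀ x, f x = x + ((Real.cos t - 1) * ⟪u, x⟫ - Real.sin t * ⟪e, x⟫) • u
      + (Real.sin t * ⟪u, x⟫ + (Real.cos t - 1) * ⟪e, x⟫) • e := by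
    intro x; simp [f]
  have hn : ∀ x, ‖f x‖ = ‖x‖ := by
    intro x
    rw [← sq_eq_sq₀ (norm_nonneg _) (norm_nonneg _), ← real_inner_self_eq_norm_sq,
      ← real_inner_self_eq_norm_sq, hf]
    simp only [inner_add_left, inner_add_right, real_inner_smul_left, real_inner_smul_right,
      huu, hee, heu, hue, real_inner_comm u x, real_inner_comm e x]
    linear_combination (⟪u, x⟫ ^ 2 + ⟪e, x⟫ ^ 2) * Real.sin_sq_add_cos_sq t
  let g : E →ₗᵢ[ℝ] E := ⟨f, hn⟩
  refine ⟨g.toLinearIsometryEquiv rfl, fun x => ?_⟩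
  have : g.toLinearIsometryEquiv rfl x = f x := rfl
  rw [this, hf]
  simp only [inner_add_right, real_inner_smul_right, huu, hee, heu, hue]
  constructor <;> ring

variable [MeasurableSpace E] [BorelSpace E]

/-- `toSphere` measures a set through the volume of the cone over it in the unit ball; a linear
isometry carries cones to cones and preserves volume. -/
theorem measurePreserving_sphereHomeomorph (e : E ≃ₗᵢ[ℝ] E) :
    MeasurePreserving (sphereHomeomorph e) (volume : Measure E).toSphere
      (volume : Measure E).toSphere := by
  refine ⟨(sphereHomeomorph e).continuous.measurable, ?_⟩
  ext s hs
  rw [Measure.map_apply (sphereHomeomorph e).continuous.measurable hs,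
    Measure.toSphere_apply' _ hs,
    Measure.toSphere_apply' _ ((sphereHomeomorph e).continuous.measurable hs)]
  congr 1
  have hset : Ioo (0 : ℝ) 1 • ((↑) '' (sphereHomeomorph e ⁻¹' s) : Set E)
      = e ⁻¹' (Ioo (0 : ℝ) 1 • ((↑) '' s)) := by
    ext x
    simp only [Set.mem_smul, mem_image, mem_preimage]
    constructor
    · rintro ⟨a, ha, _, ⟨ξ, hξ, rfl⟩, rfl⟩
      exact ⟨a, ha, _, ⟨_, hξ, rfl⟩, by simp [sphereHomeomorph]⟩
    · rintro ⟨a, ha, _, ⟨ξ, hξ, rfl⟩, hx⟩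
      refine ⟨a, ha, _, ⟨(sphereHomeomorph e).symm ξ, by simpa using hξ, rfl⟩, ?_⟩
      apply e.injective
      rw [← hx]
      simp [sphereHomeomorph]
  rw [hset]
  exact e.measurePreserving.measure_preimage_equiv (f := e.toMeasurableEquiv) _

theorem integral_toSphere_comp (e : E ≃ₗᵢ[ℝ] E) (F : E → ℝ) :
    ∫ ξ : Metric.sphere (0 : E) 1, F (e ξ) ∂(volume : Measure E).toSphere
      = ∫ ξ : Metric.sphere (0 : E) 1, F ξ ∂(volume : Measure E).toSphere :=
  (measurePreserving_sphereHomeomorph e).integral_comp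
    (sphereHomeomorph e).measurableEmbedding (fun ξ => F ξ)

/-- Zonal integrals over the sphere do not depend on the pole. -/
theorem integral_toSphere_inner_eq (F : ℝ → ℝ) {u v : E} (h : ‖u‖ = ‖v‖) :
    ∫ ξ : Metric.sphere (0 : E) 1, F ⟪u, ξ⟫ ∂(volume : Measure E).toSphere
      = ∫ ξ : Metric.sphere (0 : E) 1, F ⟪v, ξ⟫ ∂(volume : Measure E).toSphere := by
  set e := Submodule.reflection (ℝ ∙ (u - v))ᗮ
  have he : e u = v := Submodule.reflection_sub h
  rw [← integral_toSphere_comp e (fun x => F ⟪v, x⟫)]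
  congr 1
  ext ξ
  rw [← he, e.inner_map_map]



/-- Let R_t be the rotation by t in the plane of u and e. The integral of ⟪e, R_t ξ⟫ h(⟪u, R_t ξ⟫)
does not depend on t, and the identity is its derivative at t = 0. -/
theorem integral_sphere_rotation_field {u e : E} (hu : ‖u‖ = 1) (he : ‖e‖ = 1)
    (hue : ⟪u, e⟫ = 0) {h h' : ℝ → ℝ} (hd : ∀ s ∈ Icc (-1 : ℝ) 1, HasDerivAt h (h' s) s)
    (hc : ContinuousOn h' (Icc (-1) 1)) :
    ∫ ξ : Metric.sphere (0 : E) 1, (⟪u, (ξ : E)⟫ * h ⟪u, (ξ : E)⟫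
      - ⟪e, (ξ : E)⟫ ^ 2 * h' ⟪u, (ξ : E)⟫) ∂(volume : Measure E).toSphere = 0 := by
  have hmem : ∀ t : ℝ, ∀ ξ : Metric.sphere (0 : E) 1,
      Real.cos t * ⟪u, (ξ : E)⟫ - Real.sin t * ⟪e, (ξ : E)⟫ ∈ Icc (-1 : ℝ) 1 := by
    intro t ξ
    obtain ⟨Rt, hRt⟩ := exists_rotation hu he hue t
    rw [← (hRt ξ).1]
    exact inner_mem_Icc_of_sphere hu (sphereHomeomorph Rt ξ)
  have hhc : ContinuousOn h (Icc (-1) 1) := fun s hs => (hd s hs).continuousAt.continuousWithinAt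
  let F : ℝ → Metric.sphere (0 : E) 1 → ℝ := fun t ξ =>
    (Real.sin t * ⟪u, (ξ : E)⟫ + Real.cos t * ⟪e, (ξ : E)⟫)
      * h (Real.cos t * ⟪u, (ξ : E)⟫ - Real.sin t * ⟪e, (ξ : E)⟫)
  let F' : ℝ → Metric.sphere (0 : E) 1 → ℝ := fun t ξ =>
    (Real.cos t * ⟪u, (ξ : E)⟫ + -Real.sin t * ⟪e, (ξ : E)⟫)
      * h (Real.cos t * ⟪u, (ξ : E)⟫ - Real.sin t * ⟪e, (ξ : E)⟫)
    + (Real.sin t * ⟪u, (ξ : E)⟫ + Real.cos t * ⟪e, (ξ : E)⟫)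
      * (h' (Real.cos t * ⟪u, (ξ : E)⟫ - Real.sin t * ⟪e, (ξ : E)⟫)
        * (-Real.sin t * ⟪u, (ξ : E)⟫ - Real.cos t * ⟪e, (ξ : E)⟫))
  have hderiv := hasDerivAt_integral_of_compact (volume : Measure E).toSphere (F := F) (F' := F')
    isOpen_univ ?_ ?_ ?_ (mem_univ (0 : ℝ))
  · have hconst : (fun t => ∫ ξ, F t ξ ∂(volume : Measure E).toSphere)
        = fun _ => ∫ ξ, F 0 ξ ∂(volume : Measure E).toSphere := by
      funext t
      obtain ⟨Rt, hRt⟩ := exists_rotation hu he hue t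
      have := integral_toSphere_comp Rt (fun x => ⟪e, x⟫ * h ⟪u, x⟫)
      simp only [(hRt _).1, (hRt _).2] at this
      simpa [F] using this
    rw [hconst] at hderiv
    have h0 := hderiv.unique (hasDerivAt_const _ _)
    rw [← h0]
    congr 1
    ext ξ
    simp [F']
    ring
  · intro t _
    have : Continuous fun ξ : Metric.sphere (0 : E) 1 =>
        h (Real.cos t * ⟪u, (ξ : E)⟫ - Real.sin t * ⟪e, (ξ : E)⟫) :=
      hhc.comp_continuous (by fun_prop) (hmem t)
    exact Continuous.mul (by fun_prop) this
  · have h1 : Continuous fun p : ℝ × Metric.sphere (0 : E) 1 =>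
        h (Real.cos p.1 * ⟪u, (p.2 : E)⟫ - Real.sin p.1 * ⟪e, (p.2 : E)⟫) :=
      hhc.comp_continuous (by fun_prop) (fun p => hmem p.1 p.2)
    have h2 : Continuous fun p : ℝ × Metric.sphere (0 : E) 1 =>
        h' (Real.cos p.1 * ⟪u, (p.2 : E)⟫ - Real.sin p.1 * ⟪e, (p.2 : E)⟫) :=
      hc.comp_continuous (by fun_prop) (fun p => hmem p.1 p.2)
    apply Continuous.continuousOn
    exact (Continuous.mul (by fun_prop) h1).add
      (Continuous.mul (by fun_prop) (h2.mul (by fun_prop)))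
  · intro t _ ξ
    have hs := Real.hasDerivAt_sin t
    have hcos := Real.hasDerivAt_cos t
    have a1 := (hs.mul_const ⟪u, (ξ : E)⟫).add (hcos.mul_const ⟪e, (ξ : E)⟫)
    have a2 := (hcos.mul_const ⟪u, (ξ : E)⟫).sub (hs.mul_const ⟪e, (ξ : E)⟫)
    exact a1.mul ((hd _ (hmem t ξ)).comp t a2)

/-- The divergence of the zonal field `h(⟪u, ξ⟫) ∇⟪u, ξ⟫` integrates to zero over the sphere. -/
theorem integral_sphere_zonal_div {u : E} (hu : ‖u‖ = 1) {h h' : ℝ → ℝ}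
    (hd : ∀ s ∈ Icc (-1 : ℝ) 1, HasDerivAt h (h' s) s) (hc : ContinuousOn h' (Icc (-1) 1)) :
    ∫ ξ : Metric.sphere (0 : E) 1, (((Module.finrank ℝ E : ℝ) - 1) * ⟪u, (ξ : E)⟫ * h ⟪u, (ξ : E)⟫
      - (1 - ⟪u, (ξ : E)⟫ ^ 2) * h' ⟪u, (ξ : E)⟫) ∂(volume : Measure E).toSphere = 0 := by
  classical
  have hon : Orthonormal ℝ ((↑) : ({u} : Set E) → E) := by
    rw [orthonormal_subtype_iff_ite]
    intro a ha b hb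
    rw [mem_singleton_iff.1 ha, mem_singleton_iff.1 hb, real_inner_self_eq_norm_sq, hu]
    simp
  obtain ⟨w, b, hw, hb⟩ := hon.exists_orthonormalBasis_extension
  let i0 : w := ⟨u, hw rfl⟩
  have hbi : b i0 = u := by rw [hb]
  have hcard : ((Finset.univ.erase i0).card : ℝ) = (Module.finrank ℝ E : ℝ) - 1 := by
    rw [Finset.card_erase_of_mem (Finset.mem_univ _), Finset.card_univ,
      ← Module.finrank_eq_card_basis b.toBasis, Nat.cast_sub, Nat.cast_one]
    exact Nat.one_le_iff_ne_zero.2 fun h0 => by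
      have := Module.finrank_zero_iff.1 h0
      simp [Subsingleton.elim u 0] at hu
  have hint : ∀ i : w, Integrable (fun ξ : Metric.sphere (0 : E) 1 =>
      (⟪u, (ξ : E)⟫ * h ⟪u, (ξ : E)⟫ - ⟪b i, (ξ : E)⟫ ^ 2 * h' ⟪u, (ξ : E)⟫))
      (volume : Measure E).toSphere := by
    intro i
    have hhc : ContinuousOn h (Icc (-1) 1) :=
      fun s hs => (hd s hs).continuousAt.continuousWithinAt
    have h1 : Continuous fun ξ : Metric.sphere (0 : E) 1 => h ⟪u, (ξ : E)⟫ :=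
      hhc.comp_continuous (by fun_prop) (inner_mem_Icc_of_sphere hu)
    have h2 : Continuous fun ξ : Metric.sphere (0 : E) 1 => h' ⟪u, (ξ : E)⟫ :=
      hc.comp_continuous (by fun_prop) (inner_mem_Icc_of_sphere hu)
    exact Continuous.integrable_of_hasCompactSupport
      ((Continuous.mul (by fun_prop) h1).sub (Continuous.mul (by fun_prop) h2))
      (HasCompactSupport.of_compactSpace _)
  -- Add the rotation identities over the basis vectors orthogonal to u: there are d − 1 of them,
  -- and by Parseval their squared coordinates add up to 1 − ⟪u, ξ⟫².
  have hsum : ∑ i ∈ Finset.univ.erase i0, ∫ ξ : Metric.sphere (0 : E) 1,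
      (⟪u, (ξ : E)⟫ * h ⟪u, (ξ : E)⟫ - ⟪b i, (ξ : E)⟫ ^ 2 * h' ⟪u, (ξ : E)⟫)
      ∂(volume : Measure E).toSphere = 0 := by
    refine Finset.sum_eq_zero fun i hi =>
      integral_sphere_rotation_field hu (b.norm_eq_one i) ?_ hd hc
    rw [← hbi]
    exact b.inner_eq_zero (Finset.ne_of_mem_erase hi).symm
  rw [← integral_finsetSum _ (fun i _ => hint i)] at hsum
  rw [← hsum]
  congr 1
  ext ξ
  have hpars : ∑ i, ⟪b i, (ξ : E)⟫ ^ 2 = 1 := by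
    have := b.sum_sq_norm_inner_right (ξ : E)
    simpa using this
  rw [← Finset.add_sum_erase _ _ (Finset.mem_univ i0), hbi] at hpars
  rw [Finset.sum_sub_distrib, Finset.sum_const, nsmul_eq_mul, hcard, ← Finset.sum_mul]
  linear_combination (h' ⟪u, (ξ : E)⟫) * hpars

end Sphere

/-! ### The hyperbolic law of cosines. -/

/-- The hyperbolic cosine of the third side of a geodesic triangle with sides `θ`, `r` that enclose
an angle with cosine `s`. -/
noncomputable def coshSide (r θ s : ℝ) : ℝ :=
  Real.cosh θ * Real.cosh r - Real.sinh θ * Real.sinh r * s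

/-- The derivative of `coshSide` in `θ`. -/
noncomputable def coshSideDeriv (r θ s : ℝ) : ℝ :=
  Real.sinh θ * Real.cosh r - Real.cosh θ * Real.sinh r * s

theorem coshSide_comm (r θ s : ℝ) : coshSide r θ s = coshSide θ r s := by
  simp only [coshSide]; ring

theorem coshSide_zero (r s : ℝ) : coshSide r 0 s = Real.cosh r := by simp [coshSide]

theorem continuous_coshSide (r : ℝ) : Continuous (fun p : ℝ × ℝ => coshSide r p.1 p.2) := by
  unfold coshSide; fun_prop

theorem continuous_coshSideDeriv (r : ℝ) :
    Continuous (fun p : ℝ × ℝ => coshSideDeriv r p.1 p.2) := by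
  unfold coshSideDeriv; fun_prop

/-- The triangle inequality: the third side is shortest for aligned directions. It keeps w away from
the singular value 1 as soon as the two radii differ. -/
theorem cosh_abs_sub_abs_le_coshSide (r θ : ℝ) {s : ℝ} (hs : s ∈ Icc (-1 : ℝ) 1) :
    Real.cosh (|θ| - |r|) ≤ coshSide r θ s := by
  rw [Real.cosh_sub, Real.cosh_abs, Real.cosh_abs, coshSide]
  have h1 : Real.sinh |θ| * Real.sinh |r| = |Real.sinh θ * Real.sinh r| := by
    rw [abs_mul, Real.abs_sinh, Real.abs_sinh]
  have h2 : Real.sinh θ * Real.sinh r * s ≤ |Real.sinh θ * Real.sinh r| := by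
    calc _ ≤ |Real.sinh θ * Real.sinh r * s| := le_abs_self _
      _ = |Real.sinh θ * Real.sinh r| * |s| := abs_mul _ _
      _ ≤ _ := mul_le_of_le_one_right (abs_nonneg _) (abs_le.2 hs)
  linarith

theorem one_le_coshSide (r θ : ℝ) {s : ℝ} (hs : s ∈ Icc (-1 : ℝ) 1) : 1 ≤ coshSide r θ s :=
  (Real.one_le_cosh _).trans (cosh_abs_sub_abs_le_coshSide r θ hs)

theorem one_lt_coshSide {r θ : ℝ} (h : |θ| ≠ |r|) {s : ℝ} (hs : s ∈ Icc (-1 : ℝ) 1) :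
    1 < coshSide r θ s :=
  (Real.one_lt_cosh.2 (sub_ne_zero.2 h)).trans_le (cosh_abs_sub_abs_le_coshSide r θ hs)

theorem coshSide_le_cosh_abs_add_abs (r θ : ℝ) {s : ℝ} (hs : s ∈ Icc (-1 : ℝ) 1) :
    coshSide r θ s ≤ Real.cosh (|θ| + |r|) := by
  rw [Real.cosh_add, Real.cosh_abs, Real.cosh_abs, coshSide]
  have h1 : Real.sinh |θ| * Real.sinh |r| = |Real.sinh θ * Real.sinh r| := by
    rw [abs_mul, Real.abs_sinh, Real.abs_sinh]
  have h2 : -(Real.sinh θ * Real.sinh r * s) ≤ |Real.sinh θ * Real.sinh r| := by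
    calc _ ≤ |Real.sinh θ * Real.sinh r * s| := neg_le_abs _
      _ = |Real.sinh θ * Real.sinh r| * |s| := abs_mul _ _
      _ ≤ _ := mul_le_of_le_one_right (abs_nonneg _) (abs_le.2 hs)
  linarith

theorem hasDerivAt_coshSide (r θ s : ℝ) :
    HasDerivAt (fun τ => coshSide r τ s) (coshSideDeriv r θ s) θ := by
  have h1 := (Real.hasDerivAt_cosh θ).mul_const (Real.cosh r)
  have h2 := ((Real.hasDerivAt_sinh θ).mul_const (Real.sinh r)).mul_const s
  exact h1.sub h2

theorem hasDerivAt_coshSideDeriv (r θ s : ℝ) :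
    HasDerivAt (fun τ => coshSideDeriv r τ s) (coshSide r θ s) θ := by
  have h1 := (Real.hasDerivAt_sinh θ).mul_const (Real.cosh r)
  have h2 := ((Real.hasDerivAt_cosh θ).mul_const (Real.sinh r)).mul_const s
  exact h1.sub h2

theorem hasDerivAt_coshSide_cos (r θ s : ℝ) :
    HasDerivAt (fun t => coshSide r θ t) (-(Real.sinh θ * Real.sinh r)) s := by
  have h := ((hasDerivAt_id s).const_mul (Real.sinh θ * Real.sinh r)).const_sub
    (Real.cosh θ * Real.cosh r)
  exact h.congr_deriv (by ring)

/-! ### Spherical means and their flux. -/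

section SphereMean

open scoped RealInnerProductSpace

variable {E : Type*} [NormedAddCommGroup E] [InnerProductSpace ℝ E]

theorem continuousOn_comp_coshSide {u : E} {b : ℝ → ℝ} {r w₀ : ℝ} {I : Set ℝ}
    (hu : ‖u‖ = 1) (hc : ContinuousOn b (Ioi w₀))
    (hW : ∀ θ ∈ I, ∀ s ∈ Icc (-1 : ℝ) 1, w₀ < coshSide r θ s) :
    ContinuousOn (fun p : ℝ × Metric.sphere (0 : E) 1 => b (coshSide r p.1 ⟪u, (p.2 : E)⟫))
      (I ×ˢ univ) :=
  hc.comp ((continuous_coshSide r).comp (by fun_prop :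
    Continuous fun p : ℝ × Metric.sphere (0 : E) 1 => (p.1, ⟪u, (p.2 : E)⟫))).continuousOn
    (fun p hp => hW p.1 hp.1 _ (inner_mem_Icc_of_sphere hu p.2))

theorem continuous_coshSideDeriv_inner (u : E) (r : ℝ) :
    Continuous (fun p : ℝ × Metric.sphere (0 : E) 1 => coshSideDeriv r p.1 ⟪u, (p.2 : E)⟫) :=
  (continuous_coshSideDeriv r).comp (by fun_prop :
    Continuous fun p : ℝ × Metric.sphere (0 : E) 1 => (p.1, ⟪u, (p.2 : E)⟫))

theorem continuous_coshSide_inner (u : E) (r : ℝ) :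
    Continuous (fun p : ℝ × Metric.sphere (0 : E) 1 => coshSide r p.1 ⟪u, (p.2 : E)⟫) :=
  (continuous_coshSide r).comp (by fun_prop :
    Continuous fun p : ℝ × Metric.sphere (0 : E) 1 => (p.1, ⟪u, (p.2 : E)⟫))

theorem continuous_slice {X : Type*} [TopologicalSpace X] {I : Set ℝ} {F : ℝ × X → ℝ}
    (hF : ContinuousOn F (I ×ˢ univ)) {θ : ℝ} (hθ : θ ∈ I) : Continuous (fun ξ => F (θ, ξ)) :=
  hF.comp_continuous (by fun_prop) (fun _ => ⟨hθ, mem_univ _⟩)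

variable [FiniteDimensional ℝ E] [MeasurableSpace E] [BorelSpace E]

/-- The integral over the directions `ξ` of a function of the distance between the points at
distances `θ` and `r` from the origin in the directions `u` and `ξ`. -/
noncomputable def sphereMean (u : E) (B : ℝ → ℝ) (r θ : ℝ) : ℝ :=
  ∫ ξ : Metric.sphere (0 : E) 1, B (coshSide r θ ⟪u, (ξ : E)⟫) ∂(volume : Measure E).toSphere

/-- The derivative of `sphereMean` in `θ`, for `b` the derivative of the profile. -/
noncomputable def sphereMeanDeriv (u : E) (b : ℝ → ℝ) (r θ : ℝ) : ℝ :=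
  ∫ ξ : Metric.sphere (0 : E) 1, b (coshSide r θ ⟪u, (ξ : E)⟫) * coshSideDeriv r θ ⟪u, (ξ : E)⟫
    ∂(volume : Measure E).toSphere

theorem sphereMean_zero (u : E) (B : ℝ → ℝ) (r : ℝ) :
    sphereMean u B r 0 = (volume : Measure E).toSphere.real univ * B (Real.cosh r) := by
  simp [sphereMean, coshSide_zero]

theorem sphereMean_comm (u : E) (B : ℝ → ℝ) (r θ : ℝ) :
    sphereMean u B r θ = sphereMean u B θ r := by
  simp only [sphereMean, coshSide_comm r θ]

variable {u : E} {B b b' : ℝ → ℝ} {r w₀ : ℝ} {I : Set ℝ}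

theorem integrable_slice {F : ℝ × Metric.sphere (0 : E) 1 → ℝ} (hF : ContinuousOn F (I ×ˢ univ))
    {θ : ℝ} (hθ : θ ∈ I) :
    Integrable (fun ξ => F (θ, ξ)) (volume : Measure E).toSphere :=
  (continuous_slice hF hθ).integrable_of_hasCompactSupport (HasCompactSupport.of_compactSpace _)

/-- The threshold `w₀` covers two uses: `w₀ = 1` for the Green profile, singular at w = 1, with |θ|
< r; and `w₀ = 1 - ε` for shifted profiles, with θ unrestricted. -/
theorem hasDerivAt_sphereMean (hu : ‖u‖ = 1) (hB : ∀ w ∈ Ioi w₀, HasDerivAt B (b w) w)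
    (hc : ContinuousOn b (Ioi w₀)) (hI : IsOpen I)
    (hW : ∀ θ ∈ I, ∀ s ∈ Icc (-1 : ℝ) 1, w₀ < coshSide r θ s) {θ : ℝ} (hθ : θ ∈ I) :
    HasDerivAt (sphereMean u B r) (sphereMeanDeriv u b r θ) θ := by
  have hBc : ContinuousOn B (Ioi w₀) := fun w hw => (hB w hw).continuousAt.continuousWithinAt
  refine hasDerivAt_integral_of_compact (volume : Measure E).toSphere
    (F := fun θ (ξ : Metric.sphere (0 : E) 1) => B (coshSide r θ ⟪u, (ξ : E)⟫))
    (F' := fun θ (ξ : Metric.sphere (0 : E) 1) =>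
      b (coshSide r θ ⟪u, (ξ : E)⟫) * coshSideDeriv r θ ⟪u, (ξ : E)⟫) hI
    (fun τ hτ => continuous_slice (continuousOn_comp_coshSide hu hBc hW) hτ)
    ((continuousOn_comp_coshSide hu hc hW).mul (continuous_coshSideDeriv_inner u r).continuousOn)
    (fun τ hτ ξ => ?_) hθ
  exact (hB _ (hW τ hτ _ (inner_mem_Icc_of_sphere hu ξ))).comp τ (hasDerivAt_coshSide r τ _)

/-- The flux `sinh^{d-1} θ · ∂_θ` of a spherical mean has the derivative that the
Laplace-Beltrami operator of the profile prescribes. -/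
theorem hasDerivAt_sphereMean_flux (hd : 2 ≤ Module.finrank ℝ E) (hu : ‖u‖ = 1)
    (hb : ∀ w ∈ Ioi w₀, HasDerivAt b (b' w) w) (hc : ContinuousOn b' (Ioi w₀)) (hI : IsOpen I)
    (hW : ∀ θ ∈ I, ∀ s ∈ Icc (-1 : ℝ) 1, w₀ < coshSide r θ s) {θ : ℝ} (hθ : θ ∈ I) :
    HasDerivAt (fun τ => Real.sinh τ ^ (Module.finrank ℝ E - 1) * sphereMeanDeriv u b r τ)
      (Real.sinh θ ^ (Module.finrank ℝ E - 1) * ∫ ξ : Metric.sphere (0 : E) 1,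
        ((coshSide r θ ⟪u, (ξ : E)⟫ ^ 2 - 1) * b' (coshSide r θ ⟪u, (ξ : E)⟫)
          + Module.finrank ℝ E * coshSide r θ ⟪u, (ξ : E)⟫ * b (coshSide r θ ⟪u, (ξ : E)⟫))
        ∂(volume : Measure E).toSphere) θ := by
  have hbc : ContinuousOn b (Ioi w₀) := fun w hw => (hb w hw).continuousAt.continuousWithinAt
  have cb := continuousOn_comp_coshSide hu hbc hW
  have cb' := continuousOn_comp_coshSide hu hc hW
  have cD : ContinuousOn (fun p : ℝ × Metric.sphere (0 : E) 1 =>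
    coshSideDeriv r p.1 ⟪u, (p.2 : E)⟫) (I ×ˢ univ) :=
    (continuous_coshSideDeriv_inner u r).continuousOn
  have cW : ContinuousOn (fun p : ℝ × Metric.sphere (0 : E) 1 =>
    coshSide r p.1 ⟪u, (p.2 : E)⟫) (I ×ˢ univ) := (continuous_coshSide_inner u r).continuousOn
  have hm : HasDerivAt (sphereMeanDeriv u b r) (∫ ξ : Metric.sphere (0 : E) 1,
      (b' (coshSide r θ ⟪u, (ξ : E)⟫) * coshSideDeriv r θ ⟪u, (ξ : E)⟫
        * coshSideDeriv r θ ⟪u, (ξ : E)⟫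
        + b (coshSide r θ ⟪u, (ξ : E)⟫) * coshSide r θ ⟪u, (ξ : E)⟫)
        ∂(volume : Measure E).toSphere) θ := by
    refine hasDerivAt_integral_of_compact (volume : Measure E).toSphere
      (F := fun θ (ξ : Metric.sphere (0 : E) 1) =>
        b (coshSide r θ ⟪u, (ξ : E)⟫) * coshSideDeriv r θ ⟪u, (ξ : E)⟫)
      (F' := fun θ (ξ : Metric.sphere (0 : E) 1) =>
        b' (coshSide r θ ⟪u, (ξ : E)⟫) * coshSideDeriv r θ ⟪u, (ξ : E)⟫
        * coshSideDeriv r θ ⟪u, (ξ : E)⟫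
        + b (coshSide r θ ⟪u, (ξ : E)⟫) * coshSide r θ ⟪u, (ξ : E)⟫) hI
      (fun τ hτ => continuous_slice (cb.mul cD) hτ) (((cb'.mul cD).mul cD).add (cb.mul cW))
      (fun τ hτ ξ => ?_) hθ
    exact ((hb _ (hW τ hτ _ (inner_mem_Icc_of_sphere hu ξ))).comp τ
      (hasDerivAt_coshSide r τ _)).mul (hasDerivAt_coshSideDeriv r τ _)
  have hs := (Real.hasDerivAt_sinh θ).pow (Module.finrank ℝ E - 1)
  refine (hs.mul hm).congr_deriv ?_
  obtain ⟨k, hk⟩ : ∃ k, Module.finrank ℝ E = k + 2 := ⟨_, (Nat.sub_add_cancel hd).symm⟩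
  have hdiv := integral_sphere_zonal_div (E := E) hu (h := fun s => b (coshSide r θ s))
    (h' := fun s => b' (coshSide r θ s) * (-(Real.sinh θ * Real.sinh r)))
    (fun s hs => (hb _ (hW θ hθ s hs)).comp s (hasDerivAt_coshSide_cos r θ s))
    ((hc.comp ((continuous_coshSide r).comp (Continuous.prodMk_right θ)).continuousOn
      (fun s hs => hW θ hθ s hs)).mul continuousOn_const)
  have i1 : Integrable (fun ξ : Metric.sphere (0 : E) 1 =>
      b (coshSide r θ ⟪u, (ξ : E)⟫) * coshSideDeriv r θ ⟪u, (ξ : E)⟫)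
      (volume : Measure E).toSphere := integrable_slice (cb.mul cD) hθ
  have i2 : Integrable (fun ξ : Metric.sphere (0 : E) 1 =>
      b' (coshSide r θ ⟪u, (ξ : E)⟫) * coshSideDeriv r θ ⟪u, (ξ : E)⟫
        * coshSideDeriv r θ ⟪u, (ξ : E)⟫
        + b (coshSide r θ ⟪u, (ξ : E)⟫) * coshSide r θ ⟪u, (ξ : E)⟫)
      (volume : Measure E).toSphere := integrable_slice (((cb'.mul cD).mul cD).add (cb.mul cW)) hθ
  have i3 : Integrable (fun ξ : Metric.sphere (0 : E) 1 =>
      (coshSide r θ ⟪u, (ξ : E)⟫ ^ 2 - 1) * b' (coshSide r θ ⟪u, (ξ : E)⟫)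
          + ((k + 2 : ℕ) : ℝ) * coshSide r θ ⟪u, (ξ : E)⟫ * b (coshSide r θ ⟪u, (ξ : E)⟫))
      (volume : Measure E).toSphere :=
    integrable_slice ((((cW.pow 2).sub continuousOn_const).mul cb').add
      ((continuousOn_const.mul cW).mul cb)) hθ
  rw [hk] at hdiv ⊢
  have e1 : k + 2 - 1 = k + 1 := rfl
  have e2 : k + 1 - 1 = k := rfl
  simp only [e1, e2, sphereMeanDeriv]
  -- After the common factor sinh^k θ is removed, the difference of the two sides is pointwise −sinh
  -- r times the divergence integrand of `hdiv`, so it integrates to 0.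
  have key : ∫ ξ : Metric.sphere (0 : E) 1, ((k + 1 : ℝ) * Real.cosh θ
        * (b (coshSide r θ ⟪u, (ξ : E)⟫) * coshSideDeriv r θ ⟪u, (ξ : E)⟫)
      + Real.sinh θ * (b' (coshSide r θ ⟪u, (ξ : E)⟫) * coshSideDeriv r θ ⟪u, (ξ : E)⟫
        * coshSideDeriv r θ ⟪u, (ξ : E)⟫
        + b (coshSide r θ ⟪u, (ξ : E)⟫) * coshSide r θ ⟪u, (ξ : E)⟫)
      - Real.sinh θ * ((coshSide r θ ⟪u, (ξ : E)⟫ ^ 2 - 1) * b' (coshSide r θ ⟪u, (ξ : E)⟫)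
          + ((k + 2 : ℕ) : ℝ) * coshSide r θ ⟪u, (ξ : E)⟫ * b (coshSide r θ ⟪u, (ξ : E)⟫)))
      ∂(volume : Measure E).toSphere = 0 := by
    rw [← mul_zero (-Real.sinh r), ← hdiv, ← integral_const_mul]
    congr 1
    ext ξ
    simp only [coshSide, coshSideDeriv]
    have hθ2 := Real.cosh_sq θ
    have hr2 := Real.cosh_sq r
    push_cast
    set bb := b (Real.cosh θ * Real.cosh r - Real.sinh θ * Real.sinh r * ⟪u, (ξ : E)⟫)
    set bb' := b' (Real.cosh θ * Real.cosh r - Real.sinh θ * Real.sinh r * ⟪u, (ξ : E)⟫)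
    set s := ⟪u, (ξ : E)⟫
    set c := Real.cosh θ
    set S := Real.sinh θ
    set C := Real.cosh r
    set R := Real.sinh r
    linear_combination (-(k + 1 : ℝ) * R * s * bb + S * bb' * (R ^ 2 * s ^ 2 - C ^ 2)) * hθ2
      + (-(S * bb')) * hr2
  have i12 := (i1.const_mul ((k + 1 : ℝ) * Real.cosh θ)).add (i2.const_mul (Real.sinh θ))
  rw [integral_sub (by exact i12) (i3.const_mul _),
    integral_add (i1.const_mul _) (i2.const_mul _), integral_const_mul, integral_const_mul,
    integral_const_mul] at key
  push_cast at key ⊢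
  simp only [Pi.pow_apply]
  linear_combination Real.sinh θ ^ k * key

end SphereMean

/-! ### Radial Green profiles. -/

/-- `Φ` is a decreasing radial fundamental solution in dimension `n`, up to normalization. -/
structure IsGreenProfile (n : ℕ) (c : ℝ) (Φ : ℝ → ℝ) : Prop where
  pos : 0 < c
  hasDerivAt : ∀ θ, 0 < θ → HasDerivAt Φ (-(c / Real.sinh θ ^ (n - 1))) θ
  nonneg : ∀ θ, 0 ≤ θ → 0 ≤ Φ θ

theorem hasDerivAt_log_tanh_half {θ : ℝ} (hθ : 0 < θ) :
    HasDerivAt (fun τ => Real.log (Real.tanh (τ / 2))) (1 / Real.sinh θ) θ := by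
  have h2 : HasDerivAt (fun τ : ℝ => τ / 2) (1 / 2) θ := (hasDerivAt_id θ).div_const 2
  have hs : 0 < Real.sinh (θ / 2) := Real.sinh_pos_iff.2 (by linarith)
  have hc : 0 < Real.cosh (θ / 2) := Real.cosh_pos _
  have h := ((h2.sinh).div h2.cosh hc.ne').log (div_pos hs hc).ne'
  simp only [Pi.div_apply] at h
  have e : (fun τ => Real.log (Real.tanh (τ / 2)))
      = fun τ => Real.log (Real.sinh (τ / 2) / Real.cosh (τ / 2)) := by
    funext τ; rw [Real.tanh_eq_sinh_div_cosh]
  rw [e]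
  refine h.congr_deriv ?_
  have e2 : Real.sinh θ = 2 * Real.sinh (θ / 2) * Real.cosh (θ / 2) := by
    rw [← Real.sinh_two_mul]; ring_nf
  have e3 := Real.cosh_sq (θ / 2)
  rw [e2]
  field_simp
  linear_combination e3

theorem integrableOn_one_div_sinh_pow {m : ℕ} (hm : 2 ≤ m) {θ : ℝ} (hθ : 0 < θ) :
    IntegrableOn (fun ζ => 1 / Real.sinh ζ ^ m) (Ioi θ) := by
  have hi : IntegrableOn (fun ζ : ℝ => ζ ^ (-(m : ℝ))) (Ioi θ) :=
    integrableOn_Ioi_rpow_of_lt (by have : (2 : ℝ) ≤ m := by exact_mod_cast hm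
                                    linarith) hθ
  refine Integrable.mono' hi ?_ ?_
  · have : ContinuousOn (fun ζ => 1 / Real.sinh ζ ^ m) (Ioi θ) := by
      refine continuousOn_const.div (by fun_prop) fun ζ hζ => ?_
      exact (pow_pos (Real.sinh_pos_iff.2 (hθ.trans hζ)) m).ne'
    exact this.aestronglyMeasurable measurableSet_Ioi
  · refine (ae_restrict_mem measurableSet_Ioi).mono fun ζ hζ => ?_
    have hζ0 : 0 < ζ := hθ.trans hζ
    have hs : 0 < Real.sinh ζ := Real.sinh_pos_iff.2 hζ0
    rw [Real.norm_of_nonneg (by positivity), Real.rpow_neg hζ0.le, Real.rpow_natCast, ← one_div]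
    exact one_div_le_one_div_of_le (by positivity)
      (pow_le_pow_left₀ hζ0.le (Real.self_le_sinh_iff.2 hζ0.le) m)

theorem hasDerivAt_integral_Ioi {f : ℝ → ℝ} (hf : ∀ θ, 0 < θ → IntegrableOn f (Ioi θ))
    (hc : ContinuousOn f (Ioi 0)) {θ : ℝ} (hθ : 0 < θ) :
    HasDerivAt (fun τ => ∫ ζ in Ioi τ, f ζ) (-f θ) θ := by
  have h2 : 0 < θ / 2 := by linarith
  have hint : IntervalIntegrable f volume (θ / 2) θ := by
    rw [intervalIntegrable_iff_integrableOn_Ioc_of_le (by linarith)]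
    exact (hf _ h2).mono_set Ioc_subset_Ioi_self
  have hd := intervalIntegral.integral_hasDerivAt_right hint
    (hc.stronglyMeasurableAtFilter isOpen_Ioi θ hθ) (hc.continuousAt (Ioi_mem_nhds hθ))
  refine (hd.const_sub (∫ ζ in Ioi (θ / 2), f ζ)).congr_of_eventuallyEq ?_
  filter_upwards [Ioi_mem_nhds hθ] with τ hτ
  have := intervalIntegral.integral_interval_add_Ioi (hf _ h2) (hf τ hτ)
  linarith

theorem isGreenProfile_greenProfile {n : ℕ} (hn : 2 ≤ n) :
    ∃ c, IsGreenProfile n c (greenProfile n) := by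
  rcases hn.eq_or_lt with rfl | hn3
  · refine ⟨1 / (2 * Real.pi), by positivity, fun θ hθ => ?_, fun θ hθ => ?_⟩
    · have e : greenProfile 2 = fun θ => -(1 / (2 * Real.pi)) * Real.log (Real.tanh (θ / 2)) := by
        funext θ; simp [greenProfile]
      rw [e]
      refine ((hasDerivAt_log_tanh_half hθ).const_mul _).congr_deriv ?_
      simp; ring
    · simp only [greenProfile, if_true]
      -- θ = 0 is included, since distances may vanish: there the logarithm takes its default value
      -- 0.
      have h1 : Real.log (Real.tanh (θ / 2)) ≤ 0 :=
        Real.log_nonpos (by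
          rw [Real.tanh_eq_sinh_div_cosh]
          exact div_nonneg (Real.sinh_nonneg_iff.2 (by linarith)) (Real.cosh_pos _).le)
        (Real.tanh_lt_one _).le
      have h2 : 0 < 1 / (2 * Real.pi) := by positivity
      nlinarith
  · have hball : 0 < unitBallVol n :=
      ENNReal.toReal_pos (Metric.measure_ball_pos _ _ one_pos).ne' measure_ball_lt_top.ne
    have hn0 : (0 : ℝ) < n := by exact_mod_cast (by omega : 0 < n)
    have hc : 0 < 1 / (n * unitBallVol n) := by positivity
    have e : greenProfile n = fun θ =>
        1 / (n * unitBallVol n) * ∫ ζ in Ioi θ, 1 / Real.sinh ζ ^ (n - 1) := by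
      funext θ; rw [greenProfile, if_neg (by omega : n ≠ 2)]
    refine ⟨1 / (n * unitBallVol n), hc, fun θ hθ => ?_, fun θ hθ => ?_⟩
    · rw [e]
      refine ((hasDerivAt_integral_Ioi (f := fun ζ => 1 / Real.sinh ζ ^ (n - 1))
        (fun τ hτ => integrableOn_one_div_sinh_pow (by omega) hτ) ?_ hθ).const_mul _).congr_deriv ?_
      · refine continuousOn_const.div (by fun_prop) fun ζ hζ => ?_
        exact (pow_pos (Real.sinh_pos_iff.2 hζ) _).ne'
      · ring
    · rw [e]
      refine mul_nonneg hc.le (setIntegral_nonneg measurableSet_Ioi fun ζ hζ => ?_)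
      have hs : 0 < Real.sinh ζ := Real.sinh_pos_iff.2 (hθ.trans_lt hζ)
      positivity

namespace IsGreenProfile

variable {n : ℕ} {c : ℝ} {Φ : ℝ → ℝ}

theorem continuousOn (h : IsGreenProfile n c Φ) : ContinuousOn Φ (Ioi 0) :=
  fun θ hθ => (h.hasDerivAt θ hθ).continuousAt.continuousWithinAt

theorem strictAntiOn (h : IsGreenProfile n c Φ) : StrictAntiOn Φ (Ioi 0) := by
  refine strictAntiOn_of_deriv_neg (convex_Ioi 0) h.continuousOn fun θ hθ => ?_
  rw [interior_Ioi] at hθ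
  rw [(h.hasDerivAt θ hθ).deriv]
  exact neg_neg_of_pos (div_pos h.pos (pow_pos (Real.sinh_pos_iff.2 hθ) _))

/-- By the mean value theorem Φ θ − Φ R = c (R − θ) / sinh^{n-1} ξ with ξ > θ, so the volume factor
absorbs the singularity. This makes Φ integrable against bounded radial densities on a ball. -/
theorem exists_mul_sinh_pow_le (h : IsGreenProfile n c Φ) {R : ℝ} (hR : 0 < R) :
    ∃ C, ∀ θ ∈ Ioc 0 R, Φ θ * Real.sinh θ ^ (n - 1) ≤ C := by
  refine ⟨Φ R * Real.sinh R ^ (n - 1) + c * R, fun θ hθ => ?_⟩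
  have hs : 0 < Real.sinh θ := Real.sinh_pos_iff.2 hθ.1
  have hsR : Real.sinh θ ^ (n - 1) ≤ Real.sinh R ^ (n - 1) :=
    pow_le_pow_left₀ hs.le (Real.sinh_le_sinh.2 hθ.2) _
  have hΦR := h.nonneg R hR.le
  have hc := h.pos
  rcases hθ.2.eq_or_lt with rfl | hlt
  · have := mul_pos h.pos hR
    linarith
  · obtain ⟨ξ, hξ, hξ2⟩ := exists_hasDerivAt_eq_slope Φ (fun t => -(c / Real.sinh t ^ (n - 1))) hlt
      (h.continuousOn.mono fun t ht => hθ.1.trans_le ht.1)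
      (fun t ht => h.hasDerivAt t (hθ.1.trans ht.1))
    have hsξ : Real.sinh θ ^ (n - 1) ≤ Real.sinh ξ ^ (n - 1) :=
      pow_le_pow_left₀ hs.le (Real.sinh_le_sinh.2 hξ.1.le) _
    have hsξ0 : 0 < Real.sinh ξ ^ (n - 1) :=
      pow_pos (Real.sinh_pos_iff.2 (hθ.1.trans hξ.1)) _
    have e : Φ θ = Φ R + (R - θ) * c / Real.sinh ξ ^ (n - 1) := by
      have : R - θ ≠ 0 := by linarith
      field_simp at hξ2 ⊢
      linarith
    rw [e, add_mul]
    refine add_le_add (mul_le_mul_of_nonneg_left hsR hΦR) ?_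
    rw [div_mul_eq_mul_div, div_le_iff₀ hsξ0]
    have h1 : (R - θ) * c ≤ c * R := by nlinarith [hθ.1]
    have h2 : 0 ≤ (R - θ) * c := mul_nonneg (by linarith) hc.le
    exact mul_le_mul h1 hsξ (pow_pos hs _).le (by positivity)

/-- A function is convex in the variable `-Φ` when its flux is monotone. -/
theorem slope_le_of_flux (h : IsGreenProfile n c Φ) {f f' : ℝ → ℝ}
    (hf : ∀ θ, 0 < θ → HasDerivAt f (f' θ) θ)
    (hmono : MonotoneOn (fun θ => Real.sinh θ ^ (n - 1) * f' θ) (Ioi 0)) {x y z : ℝ}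
    (hx : 0 < x) (hxy : x < y) (hyz : y < z) :
    (f y - f x) * (Φ y - Φ z) ≤ (f z - f y) * (Φ x - Φ y) := by
  have hfc : ContinuousOn f (Ioi 0) := fun θ hθ => (hf θ hθ).continuousAt.continuousWithinAt
  -- Cauchy's mean value theorem for the pair f, Φ: the slope of f in the variable −Φ is the flux at
  -- an intermediate point, divided by c.
  have key : ∀ p q, 0 < p → p < q → ∃ t ∈ Ioo p q,
      c * (f q - f p) = (Φ p - Φ q) * (Real.sinh t ^ (n - 1) * f' t) := by
    intro p q hp hpq
    obtain ⟨t, ht, ht2⟩ := exists_ratio_hasDerivAt_eq_ratio_slope f f' hpq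
      (hfc.mono fun s hs => hp.trans_le hs.1) (fun s hs => hf s (hp.trans hs.1)) Φ
      (fun t => -(c / Real.sinh t ^ (n - 1)))
      (h.continuousOn.mono fun s hs => hp.trans_le hs.1)
      (fun s hs => h.hasDerivAt s (hp.trans hs.1))
    refine ⟨t, ht, ?_⟩
    have hs : 0 < Real.sinh t ^ (n - 1) := pow_pos (Real.sinh_pos_iff.2 (hp.trans ht.1)) _
    field_simp at ht2
    linear_combination ht2
  obtain ⟨t₁, ht₁, e₁⟩ := key x y hx hxy
  obtain ⟨t₂, ht₂, e₂⟩ := key y z (hx.trans hxy) hyz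
  have hm := hmono (hx.trans ht₁.1) ((hx.trans hxy).trans ht₂.1) (ht₁.2.trans ht₂.1).le
  have d₁ : 0 < Φ x - Φ y := sub_pos.2 (h.strictAntiOn hx (hx.trans hxy) hxy)
  have d₂ : 0 < Φ y - Φ z :=
    sub_pos.2 (h.strictAntiOn (hx.trans hxy) ((hx.trans hxy).trans hyz) hyz)
  refine le_of_mul_le_mul_left ?_ h.pos
  have hm' := mul_le_mul_of_nonneg_left hm (mul_pos d₁ d₂).le
  calc _ = (c * (f y - f x)) * (Φ y - Φ z) := by ring
    _ ≤ (c * (f z - f y)) * (Φ x - Φ y) := by rw [e₁, e₂]; simp only at hm'; linarith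
    _ = _ := by ring

/-! ### Newton's theorem. -/

section Newton

open scoped RealInnerProductSpace

theorem hasDerivAt_sqrt_sq_sub_one {w : ℝ} (hw : 1 < w) :
    HasDerivAt (fun w : ℝ => √(w ^ 2 - 1)) (w / √(w ^ 2 - 1)) w := by
  have h0 : 0 < w ^ 2 - 1 := by nlinarith
  have h := (((hasDerivAt_id w).pow 2).sub_const 1).sqrt h0.ne'
  refine h.congr_deriv ?_
  have : 0 < √(w ^ 2 - 1) := Real.sqrt_pos.2 h0
  simp
  field_simp

theorem hasDerivAt_comp_arcosh (h : IsGreenProfile n c Φ) (hn : 2 ≤ n) {w : ℝ} (hw : 1 < w) :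
    HasDerivAt (fun w => Φ (Real.arcosh w)) (-c * (√(w ^ 2 - 1) ^ n)⁻¹) w := by
  refine ((h.hasDerivAt _ (Real.arcosh_pos hw)).comp w (Real.hasDerivAt_arcosh hw)).congr_deriv ?_
  rw [Real.sinh_arcosh hw.le]
  obtain ⟨k, rfl⟩ : ∃ k, n = k + 1 := ⟨n - 1, by omega⟩
  rw [Nat.add_sub_cancel, pow_succ (√(w ^ 2 - 1)) k, mul_inv]
  ring

theorem hasDerivAt_inv_sqrt_pow {w : ℝ} (hw : 1 < w) (n : ℕ) (c : ℝ) :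
    HasDerivAt (fun w : ℝ => -c * (√(w ^ 2 - 1) ^ n)⁻¹)
      (c * n * w * (√(w ^ 2 - 1) ^ (n + 2))⁻¹) w := by
  have hs : 0 < √(w ^ 2 - 1) := Real.sqrt_pos.2 (by nlinarith)
  have h := ((((hasDerivAt_sqrt_sq_sub_one hw).pow n).inv (pow_pos hs n).ne').const_mul (-c))
  refine h.congr_deriv ?_
  simp only [Pi.pow_apply]
  rcases n with _ | k
  · simp
  · rw [Nat.add_sub_cancel]
    field_simp
    ring

variable {E : Type*} [NormedAddCommGroup E] [InnerProductSpace ℝ E]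
  [FiniteDimensional ℝ E] [MeasurableSpace E] [BorelSpace E]

/-- For |τ| < r the profile is evaluated where it is harmonic, so the flux of the mean is constant
in τ. It vanishes at τ = 0 because of the factor sinh^{n-1}; hence the mean keeps its value at the
centre. -/
theorem sphereMean_eq_of_lt (h : IsGreenProfile n c Φ) (hn : 2 ≤ n)
    (hE : Module.finrank ℝ E = n) {u : E} (hu : ‖u‖ = 1) {r θ : ℝ} (hθ : 0 ≤ θ) (hr : θ < r) :
    sphereMean u (fun w => Φ (Real.arcosh w)) r θ
      = (volume : Measure E).toSphere.real univ * Φ r := by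
  have hr0 : 0 < r := hθ.trans_lt hr
  have h0 : sphereMean u (fun w => Φ (Real.arcosh w)) r 0
      = (volume : Measure E).toSphere.real univ * Φ r := by
    rw [sphereMean_zero, Real.arcosh_cosh hr0.le]
  rcases hθ.eq_or_lt with rfl | hθ0
  · exact h0
  -- Negative τ is allowed so that 0, where the flux vanishes, is an interior point.
  have hW : ∀ τ ∈ Ioo (-r) r, ∀ s ∈ Icc (-1 : ℝ) 1, 1 < coshSide r τ s := by
    intro τ hτ s hs
    refine one_lt_coshSide ?_ hs
    rw [abs_of_pos hr0]
    exact (abs_lt.2 hτ).ne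
  have hsub : Icc 0 θ ⊆ Ioo (-r) r := fun τ hτ => ⟨by linarith [hτ.1], hτ.2.trans_lt hr⟩
  have hbc : ContinuousOn (fun w : ℝ => -c * (√(w ^ 2 - 1) ^ n)⁻¹) (Ioi 1) :=
    fun w hw => (hasDerivAt_inv_sqrt_pow hw n c).continuousAt.continuousWithinAt
  have hb'c : ContinuousOn (fun w : ℝ => c * n * w * (√(w ^ 2 - 1) ^ (n + 2))⁻¹) (Ioi 1) := by
    refine ContinuousOn.mul (by fun_prop) (ContinuousOn.inv₀ (by fun_prop) fun w hw => ?_)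
    exact (pow_pos (Real.sqrt_pos.2 (by nlinarith [mem_Ioi.1 hw])) _).ne'
  have hflux : ∀ τ ∈ Ioo (-r) r, HasDerivAt (fun τ => Real.sinh τ ^ (n - 1)
      * sphereMeanDeriv u (fun w : ℝ => -c * (√(w ^ 2 - 1) ^ n)⁻¹) r τ) 0 τ := by
    intro τ hτ
    have := hasDerivAt_sphereMean_flux (hE ▸ hn) hu (fun w hw => hasDerivAt_inv_sqrt_pow hw n c)
      hb'c isOpen_Ioo hW hτ
    rw [hE] at this
    refine this.congr_deriv ?_
    have e : ∀ ξ : Metric.sphere (0 : E) 1,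
        ((coshSide r τ ⟪u, (ξ : E)⟫ ^ 2 - 1)
          * (c * n * coshSide r τ ⟪u, (ξ : E)⟫
            * (√(coshSide r τ ⟪u, (ξ : E)⟫ ^ 2 - 1) ^ (n + 2))⁻¹)
          + n * coshSide r τ ⟪u, (ξ : E)⟫
            * (-c * (√(coshSide r τ ⟪u, (ξ : E)⟫ ^ 2 - 1) ^ n)⁻¹)) = 0 := by
      intro ξ
      have hw := hW τ hτ _ (inner_mem_Icc_of_sphere hu ξ)
      set w := coshSide r τ ⟪u, (ξ : E)⟫
      have h0 : 0 < w ^ 2 - 1 := by nlinarith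
      have hs : 0 < √(w ^ 2 - 1) := Real.sqrt_pos.2 h0
      have hsq : √(w ^ 2 - 1) ^ 2 = w ^ 2 - 1 := Real.sq_sqrt h0.le
      rw [pow_add, hsq]
      field_simp
      ring
    simp only [e, integral_zero, mul_zero]
  have hd : ∀ τ ∈ Ioo 0 θ, HasDerivAt (sphereMean u (fun w => Φ (Real.arcosh w)) r) 0 τ := by
    intro τ hτ
    have hτ' := hsub (Ioo_subset_Icc_self hτ)
    refine (hasDerivAt_sphereMean hu (fun w hw => h.hasDerivAt_comp_arcosh hn hw) hbc
      isOpen_Ioo hW hτ').congr_deriv ?_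
    have hsub' : Icc 0 τ ⊆ Ioo (-r) r := (Icc_subset_Icc_right hτ.2.le).trans hsub
    obtain ⟨t, ht, ht2⟩ := exists_hasDerivAt_eq_slope _ _ hτ.1
      (fun s hs => (hflux s (hsub' hs)).continuousAt.continuousWithinAt)
      (fun s hs => hflux s (hsub' (Ioo_subset_Icc_self hs)))
    have hτ0 : τ - 0 ≠ 0 := by linarith [hτ.1]
    rw [eq_comm, div_eq_zero_iff, or_iff_left hτ0, Real.sinh_zero,
      zero_pow (by omega), zero_mul, sub_zero, mul_eq_zero] at ht2
    exact ht2.resolve_left (pow_pos (Real.sinh_pos_iff.2 hτ.1) _).ne'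
  obtain ⟨t, ht, ht2⟩ := exists_hasDerivAt_eq_slope _ _ hθ0
    (fun s hs => (hasDerivAt_sphereMean hu (fun w hw => h.hasDerivAt_comp_arcosh hn hw) hbc
      isOpen_Ioo hW (hsub hs)).continuousAt.continuousWithinAt) hd
  have hθ' : θ - 0 ≠ 0 := by linarith
  rw [eq_comm, div_eq_zero_iff, or_iff_left hθ'] at ht2
  rw [← h0]
  linarith

/-- Newton's theorem on the hyperbolic space. -/
theorem sphereMean_eq (h : IsGreenProfile n c Φ) (hn : 2 ≤ n)
    (hE : Module.finrank ℝ E = n) {u : E} (hu : ‖u‖ = 1) {r θ : ℝ} (hθ : 0 ≤ θ) (hr : 0 ≤ r)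
    (hne : θ ≠ r) :
    sphereMean u (fun w => Φ (Real.arcosh w)) r θ
      = (volume : Measure E).toSphere.real univ * Φ (max θ r) := by
  rcases hne.lt_or_gt with hlt | hlt
  · rw [max_eq_right hlt.le, h.sphereMean_eq_of_lt hn hE hu hθ hlt]
  · rw [max_eq_left hlt.le, sphereMean_comm, h.sphereMean_eq_of_lt hn hE hu hr hlt]

end Newton

end IsGreenProfile

/-! ### The Laplace–Beltrami operator on functions of the height x₀. -/

section Laplacian

open scoped RealInnerProductSpace

variable {n : ℕ}

theorem hasFDerivAt_comp_sqrt_one_add_norm_sq {B : ℝ → ℝ} {u : EuclideanSpace ℝ (Fin n)} {β : ℝ}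
    (hB : HasDerivAt B β (√(1 + ‖u‖ ^ 2))) :
    HasFDerivAt (fun v : EuclideanSpace ℝ (Fin n) => B (√(1 + ‖v‖ ^ 2)))
      ((β / √(1 + ‖u‖ ^ 2)) • innerSL ℝ u) u := by
  have hpos : 0 < 1 + ‖u‖ ^ 2 := by positivity
  have h1 := ((hasStrictFDerivAt_norm_sq u).hasFDerivAt.const_add 1).sqrt hpos.ne'
  refine (hB.comp_hasFDerivAt u h1).congr_fderiv ?_
  ext v
  have : 0 < √(1 + ‖u‖ ^ 2) := Real.sqrt_pos.2 hpos
  simp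
  field_simp

theorem sqrt_det_hypMetric (u : EuclideanSpace ℝ (Fin n)) :
    Real.sqrt (hypMetric u).det = 1 / √(1 + ‖u‖ ^ 2) := by
  rw [hypMetric_det, Real.sqrt_div zero_le_one, Real.sqrt_one]

theorem hypGraph_coe_zero (u : EuclideanSpace ℝ (Fin n)) :
    (hypGraph u).1 0 = √(1 + ‖u‖ ^ 2) := rfl

theorem one_lt_sqrt_one_add_norm_sq {u : EuclideanSpace ℝ (Fin n)} (hu : u ≠ 0) :
    1 < √(1 + ‖u‖ ^ 2) := by
  have : 0 < ‖u‖ := norm_pos_iff.2 hu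
  rw [Real.lt_sqrt zero_le_one]
  nlinarith

/-- The Laplace-Beltrami operator on a function of `x₀ = cosh d(x, v)`. -/
theorem laplaceBeltrami_comp_zero {B b b' : ℝ → ℝ} (hB : ∀ w, 1 < w → HasDerivAt B (b w) w)
    (hb : ∀ w, 1 < w → HasDerivAt b (b' w) w) {u : EuclideanSpace ℝ (Fin n)} (hu : u ≠ 0) :
    laplaceBeltrami (fun z => B (z.1 0)) (hypGraph u)
      = (√(1 + ‖u‖ ^ 2) ^ 2 - 1) * b' (√(1 + ‖u‖ ^ 2))
        + n * √(1 + ‖u‖ ^ 2) * b (√(1 + ‖u‖ ^ 2)) := by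
  have hpart : ∀ v : EuclideanSpace ℝ (Fin n), v ≠ 0 → ∀ j,
      partialD j (fun u => B ((hypGraph u).1 0)) v
        = b (√(1 + ‖v‖ ^ 2)) * (v j / √(1 + ‖v‖ ^ 2)) := by
    intro v hv j
    simp only [partialD, hypGraph_coe_zero]
    rw [(hasFDerivAt_comp_sqrt_one_add_norm_sq (hB _ (one_lt_sqrt_one_add_norm_sq hv))).fderiv]
    simp [EuclideanSpace.inner_single_right]
    ring
  -- With w² = 1 + |v|², the inverse metric multiplies v by w², which cancels the two factors 1/w
  -- from the density and from the gradient of w. What remains is the field b(w) v, whose flat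
  -- divergence is elementary.
  have hfield : ∀ i : Fin n, ∀ v : EuclideanSpace ℝ (Fin n), v ≠ 0 →
      Real.sqrt (hypMetric v).det * ∑ j : Fin n, (hypMetric v)⁻¹ i j *
        partialD j (fun u => B ((hypGraph u).1 0)) v = b (√(1 + ‖v‖ ^ 2)) * v i := by
    intro i v hv
    have hw : 0 < √(1 + ‖v‖ ^ 2) := Real.sqrt_pos.2 (by positivity)
    have hw2 : √(1 + ‖v‖ ^ 2) ^ 2 = 1 + ‖v‖ ^ 2 := Real.sq_sqrt (by positivity)
    have e : ∀ j, (hypMetric v)⁻¹ i j * partialD j (fun u => B ((hypGraph u).1 0)) v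
        = (if i = j then b (√(1 + ‖v‖ ^ 2)) / √(1 + ‖v‖ ^ 2) * v i else 0)
          + b (√(1 + ‖v‖ ^ 2)) / √(1 + ‖v‖ ^ 2) * v i * (v j * v j) := by
      intro j
      rw [hpart v hv, hypMetric_inv_apply]
      by_cases h : i = j
      · subst h; simp; ring
      · simp [h]; ring
    simp only [e]
    rw [Finset.sum_add_distrib, ← Finset.mul_sum, sum_sq_eq_norm_sq, sqrt_det_hypMetric]
    simp only [Finset.sum_ite_eq, Finset.mem_univ, if_true]
    field_simp
    rw [hw2]
  have hdiv : ∀ i : Fin n, partialD i (fun v => Real.sqrt (hypMetric v).det *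
      ∑ j : Fin n, (hypMetric v)⁻¹ i j * partialD j (fun u => B ((hypGraph u).1 0)) v) u
      = b' (√(1 + ‖u‖ ^ 2)) / √(1 + ‖u‖ ^ 2) * (u i * u i) + b (√(1 + ‖u‖ ^ 2)) := by
    intro i
    have hev : (fun v => Real.sqrt (hypMetric v).det *
        ∑ j : Fin n, (hypMetric v)⁻¹ i j * partialD j (fun u => B ((hypGraph u).1 0)) v)
        =ᶠ[nhds u] fun v => b (√(1 + ‖v‖ ^ 2)) * v i := by
      filter_upwards [isOpen_ne.mem_nhds hu] with v hv using hfield i v hv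
    have h1 := hasFDerivAt_comp_sqrt_one_add_norm_sq (hb _ (one_lt_sqrt_one_add_norm_sq hu))
    have h2 : HasFDerivAt (fun v : EuclideanSpace ℝ (Fin n) => v i)
        (EuclideanSpace.proj i : EuclideanSpace ℝ (Fin n) →L[ℝ] ℝ) u :=
      (EuclideanSpace.proj i : EuclideanSpace ℝ (Fin n) →L[ℝ] ℝ).hasFDerivAt
    have h3 : HasFDerivAt (fun v : EuclideanSpace ℝ (Fin n) => b (√(1 + ‖v‖ ^ 2)) * v i) _ u :=
      h1.mul h2
    rw [partialD, hev.fderiv_eq, h3.fderiv]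
    simp [EuclideanSpace.inner_single_right]
    ring
  have hw : 0 < √(1 + ‖u‖ ^ 2) := Real.sqrt_pos.2 (by positivity)
  have hw2 : √(1 + ‖u‖ ^ 2) ^ 2 = 1 + ‖u‖ ^ 2 := Real.sq_sqrt (by positivity)
  rw [laplaceBeltrami, hypCoord_hypGraph]
  simp only [hdiv]
  rw [Finset.sum_add_distrib, ← Finset.mul_sum, sum_sq_eq_norm_sq, sqrt_det_hypMetric]
  simp only [Finset.sum_const, Finset.card_univ, Fintype.card_fin, nsmul_eq_mul]
  rw [hw2]
  field_simp
  ring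

theorem lorentz_hypVertex_right (x : HypSpace n) : lorentz x.1 (hypVertex n).1 = x.1 0 := by
  simp [lorentz, hypVertex]

theorem lorentz_comm (x y : Fin (n + 1) → ℝ) : lorentz x y = lorentz y x := by
  simp only [lorentz, mul_comm]

end Laplacian

/-! ### Subharmonic profiles: regularization at the diagonal and convexity of means. -/

/-- A radial profile in the variable `w = cosh θ` that is subharmonic away from the origin and
continuous there, together with its first two derivatives. -/
structure IsSubharmonicProfile (n : ℕ) (B b b' : ℝ → ℝ) : Prop where
  continuousOn : ContinuousOn B (Ici 1)
  hasDerivAt : ∀ w, 1 < w → HasDerivAt B (b w) w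
  hasDerivAt' : ∀ w, 1 < w → HasDerivAt b (b' w) w
  continuousOn' : ContinuousOn b' (Ioi 1)
  laplace_nonneg : ∀ w, 1 < w → 0 ≤ (w ^ 2 - 1) * b' w + n * w * b w

/-- It suffices to test the hypothesis with y the vertex, where the distance depends on x₀ alone, at
one point x of each height w > 1. -/
theorem isSubharmonicProfile_comp_arcosh {n : ℕ} (hn : 2 ≤ n) {A : ℝ → ℝ}
    (hA_cont : ContinuousOn A (Ici 0)) (hA_smooth : ContDiffOn ℝ 2 A (Ioi 0))
    (hA_laplace : ∀ x y : HypSpace n, x ≠ y →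
      0 ≤ laplaceBeltrami (fun z => A (hypDist z y)) x) :
    ∃ b b', IsSubharmonicProfile n (fun w => A (Real.arcosh w)) b b' := by
  have hsm : ContDiffOn ℝ 2 (fun w => A (Real.arcosh w)) (Ioi 1) :=
    hA_smooth.comp Real.contDiffOn_arcosh fun w hw => Real.arcosh_pos hw
  have hsm1 : ContDiffOn ℝ 1 (deriv fun w => A (Real.arcosh w)) (Ioi 1) :=
    ((contDiffOn_succ_iff_deriv_of_isOpen (n := 1) isOpen_Ioi).1 hsm).2.2
  have h1 : ∀ w, 1 < w → HasDerivAt (fun w => A (Real.arcosh w))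
      (deriv (fun w => A (Real.arcosh w)) w) w := fun w hw =>
    ((hsm.differentiableOn (by norm_num)).differentiableAt (Ioi_mem_nhds hw)).hasDerivAt
  have h2 : ∀ w, 1 < w → HasDerivAt (deriv fun w => A (Real.arcosh w))
      (deriv (deriv fun w => A (Real.arcosh w)) w) w := fun w hw =>
    ((hsm1.differentiableOn (by norm_num)).differentiableAt (Ioi_mem_nhds hw)).hasDerivAt
  refine ⟨_, _, hA_cont.comp Real.continuousOn_arcosh fun w hw => Real.arcosh_nonneg hw,
    h1, h2, hsm1.continuousOn_deriv_of_isOpen isOpen_Ioi le_rfl, fun w hw => ?_⟩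
  let i : Fin n := ⟨0, by omega⟩
  have hw0 : 0 < w ^ 2 - 1 := by nlinarith
  let u : EuclideanSpace ℝ (Fin n) := EuclideanSpace.single i √(w ^ 2 - 1)
  have hnorm : ‖u‖ = √(w ^ 2 - 1) := by
    rw [PiLp.norm_single, Real.norm_of_nonneg (Real.sqrt_nonneg _)]
  have hu : u ≠ 0 := by
    rw [← norm_pos_iff, hnorm]
    exact Real.sqrt_pos.2 hw0
  have hwu : √(1 + ‖u‖ ^ 2) = w := by
    rw [hnorm, Real.sq_sqrt hw0.le, add_sub_cancel, Real.sqrt_sq (by linarith)]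
  have hne : hypGraph u ≠ hypVertex n := by
    intro h
    have h0 := congrArg (fun x : HypSpace n => x.1 0) h
    simp only [hypGraph_coe_zero, hwu, hypVertex, Pi.single_eq_same] at h0
    exact hw.ne' h0
  have h := hA_laplace _ _ hne
  simp only [hypDist, lorentz_hypVertex_right] at h
  rwa [laplaceBeltrami_comp_zero (B := fun w => A (Real.arcosh w)) h1 h2 hu, hwu] at h

namespace IsSubharmonicProfile

variable {n : ℕ} {B b b' : ℝ → ℝ}

/-- The derivative of (w² − 1)^{n/2} b is (w² − 1)^{n/2 − 1} times the Laplacian of the profile. -/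
theorem monotoneOn_flux (h : IsSubharmonicProfile n B b b') (hn : 2 ≤ n) :
    MonotoneOn (fun w => √(w ^ 2 - 1) ^ n * b w) (Ioi 1) := by
  obtain ⟨k, rfl⟩ : ∃ k, n = k + 2 := ⟨n - 2, by omega⟩
  have hd : ∀ w, 1 < w → HasDerivAt (fun w => √(w ^ 2 - 1) ^ (k + 2) * b w)
      (√(w ^ 2 - 1) ^ k * ((w ^ 2 - 1) * b' w + (k + 2 : ℕ) * w * b w)) w := by
    intro w hw
    have h0 : 0 < w ^ 2 - 1 := by nlinarith
    have hs : 0 < √(w ^ 2 - 1) := Real.sqrt_pos.2 h0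
    have hsq : √(w ^ 2 - 1) ^ 2 = w ^ 2 - 1 := Real.sq_sqrt h0.le
    refine (((IsGreenProfile.hasDerivAt_sqrt_sq_sub_one hw).pow (k + 2)).mul
      (h.hasDerivAt' w hw)).congr_deriv ?_
    simp only [Pi.pow_apply]
    rw [show k + 2 - 1 = k + 1 from rfl, ← hsq, Real.sqrt_sq hs.le]
    field_simp
    ring
  refine monotoneOn_of_deriv_nonneg (convex_Ioi 1)
    (fun w hw => (hd w hw).continuousAt.continuousWithinAt)
    (fun w hw => (hd w (interior_subset hw)).differentiableAt.differentiableWithinAt)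
    fun w hw => ?_
  rw [(hd w (interior_subset hw)).deriv]
  exact mul_nonneg (pow_nonneg (Real.sqrt_nonneg _) _) (h.laplace_nonneg w (interior_subset hw))

/-- If b(w₁) < 0, the monotone flux stays below a constant −a < 0 on (1, w₁]. As n ≥ 2, (w² −
1)^{n/2} ≤ M (w − 1) there, so b ≤ −k/(w − 1) with k = a/M, and B would blow up logarithmically at w
= 1, against its continuity. -/
theorem deriv_nonneg (h : IsSubharmonicProfile n B b b') (hn : 2 ≤ n) {w₁ : ℝ} (hw₁ : 1 < w₁) :
    0 ≤ b w₁ := by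
  by_contra! hneg
  have hs₁ : 0 < √(w₁ ^ 2 - 1) := Real.sqrt_pos.2 (by nlinarith)
  obtain ⟨m, rfl⟩ : ∃ m, n = m + 2 := ⟨n - 2, by omega⟩
  set a := -(√(w₁ ^ 2 - 1) ^ (m + 2) * b w₁) with ha
  have ha0 : 0 < a := by
    have := mul_neg_of_pos_of_neg (pow_pos hs₁ (m + 2)) hneg
    linarith
  set M := (w₁ + 1) * √(w₁ ^ 2 - 1) ^ m with hM
  have hM0 : 0 < M := by positivity
  have hb : ∀ w, 1 < w → w ≤ w₁ → b w + a / M / (w - 1) ≤ 0 := by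
    intro w hw hw'
    have hm := h.monotoneOn_flux hn (mem_Ioi.2 hw) (mem_Ioi.2 hw₁) hw'
    simp only at hm
    have h0 : 0 < w ^ 2 - 1 := by nlinarith
    have hs : 0 < √(w ^ 2 - 1) := Real.sqrt_pos.2 h0
    have hle : √(w ^ 2 - 1) ≤ √(w₁ ^ 2 - 1) := Real.sqrt_le_sqrt (by nlinarith)
    have hp : √(w ^ 2 - 1) ^ (m + 2) ≤ M * (w - 1) := by
      rw [pow_add, Real.sq_sqrt h0.le, hM]
      have := pow_le_pow_left₀ hs.le hle m
      calc √(w ^ 2 - 1) ^ m * (w ^ 2 - 1)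
          ≤ √(w₁ ^ 2 - 1) ^ m * ((w₁ + 1) * (w - 1)) :=
            mul_le_mul this (by nlinarith) h0.le (by positivity)
        _ = _ := by ring
    have hbneg : b w < 0 := by
      by_contra! hbw
      have := mul_nonneg (pow_pos hs (m + 2)).le hbw
      linarith
    have h3 : M * (w - 1) * b w ≤ -a := by
      have := mul_le_mul_of_nonpos_right hp hbneg.le
      linarith
    have hMw : 0 < M * (w - 1) := mul_pos hM0 (by linarith)
    rw [div_div, ← sub_neg_eq_add, sub_nonpos, ← neg_div, le_div_iff₀ hMw]
    linarith
  set k := a / M with hk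
  have hk0 : 0 < k := by positivity
  have hd : ∀ w, 1 < w → HasDerivAt (fun w => B w + k * Real.log (w - 1))
      (b w + k / (w - 1)) w := by
    intro w hw
    have h1 : w - 1 ≠ 0 := by linarith
    refine ((h.hasDerivAt w hw).add
      ((((hasDerivAt_id w).sub_const 1).log h1).const_mul k)).congr_deriv ?_
    simp [div_eq_mul_inv]
  have hanti : AntitoneOn (fun w => B w + k * Real.log (w - 1)) (Ioc 1 w₁) := by
    refine antitoneOn_of_deriv_nonpos (convex_Ioc 1 w₁)
      (fun w hw => (hd w hw.1).continuousAt.continuousWithinAt)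
      (fun w hw => (hd w (interior_subset hw).1).differentiableAt.differentiableWithinAt)
      fun w hw => ?_
    rw [(hd w (interior_subset hw).1).deriv]
    exact hb w (interior_subset hw).1 (interior_subset hw).2
  obtain ⟨C, hC⟩ := (isCompact_Icc (a := (1 : ℝ)) (b := w₁)).exists_bound_of_continuousOn
    (h.continuousOn.mono Icc_subset_Ici_self)
  set V := B w₁ + k * Real.log (w₁ - 1)
  -- Chosen so that k log t ≤ V − C − k, which would force B(1 + t) ≥ C + k, above the bound C.
  set t := min (w₁ - 1) (Real.exp ((V - C) / k - 1)) with ht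
  have ht0 : 0 < t := lt_min (by linarith) (Real.exp_pos _)
  have htw : 1 + t ∈ Ioc 1 w₁ := 
    ⟨by linarith, by have := min_le_left (w₁ - 1) (Real.exp ((V - C) / k - 1)); linarith⟩
  have h1 := hanti htw (right_mem_Ioc.2 hw₁) htw.2
  have h2 : Real.log (1 + t - 1) ≤ (V - C) / k - 1 := by
    rw [add_sub_cancel_left, ← Real.log_exp ((V - C) / k - 1)]
    exact Real.log_le_log ht0 (min_le_right _ _)
  have h3 := (abs_le.1 (hC _ (Ioc_subset_Icc_self htw))).2
  have h4 := mul_le_mul_of_nonneg_left h2 hk0.le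
  have h5 : k * ((V - C) / k - 1) = V - C - k := by field_simp
  simp only at h1
  linarith

/-- Put W = w + ε. Multiplied by W² − 1, the expression equals (w² − 1) times the Laplacian at W
plus n b(W)(wW + 1)ε; the second term is nonnegative because b ≥ 0. -/
theorem shift_laplace_nonneg (h : IsSubharmonicProfile n B b b') (hn : 2 ≤ n) {w ε : ℝ}
    (hw : 1 ≤ w) (hε : 0 < ε) :
    0 ≤ (w ^ 2 - 1) * b' (w + ε) + n * w * b (w + ε) := by
  have hW : 1 < w + ε := by linarith
  have hb := h.deriv_nonneg hn hW
  have hL := h.laplace_nonneg _ hW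
  set W := w + ε
  have hn0 : (0 : ℝ) ≤ n := n.cast_nonneg
  have hw2 : 0 ≤ w ^ 2 - 1 := by nlinarith
  have hW2 : 0 < W ^ 2 - 1 := by nlinarith
  refine nonneg_of_mul_nonneg_right ?_ hW2
  have h1 := mul_nonneg hw2 hL
  have h2 : 0 ≤ w * (W ^ 2 - 1) - W * (w ^ 2 - 1) := by
    have e : w * (W ^ 2 - 1) - W * (w ^ 2 - 1) = (w * W + 1) * ε := by simp only [W]; ring
    rw [e]
    exact mul_nonneg (by nlinarith) hε.le
  have h3 := mul_nonneg (mul_nonneg hn0 hb) h2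
  linarith

open scoped RealInnerProductSpace

variable {E : Type*} [NormedAddCommGroup E] [InnerProductSpace ℝ E]
  [FiniteDimensional ℝ E] [MeasurableSpace E] [BorelSpace E]

theorem tendsto_sphereMean_shift (hB : ContinuousOn B (Ici 1)) {u : E}
    (hu : ‖u‖ = 1) (r θ : ℝ) :
    Filter.Tendsto (fun ε => sphereMean u (fun w => B (w + ε)) r θ) (nhdsWithin 0 (Ioi 0))
      (nhds (sphereMean u B r θ)) := by
  have hmem := fun ξ : Metric.sphere (0 : E) 1 => inner_mem_Icc_of_sphere hu ξ
  have hcW : Continuous fun ξ : Metric.sphere (0 : E) 1 => coshSide r θ ⟪u, (ξ : E)⟫ :=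
    (continuous_coshSide_inner u r).comp (Continuous.prodMk_right θ)
  obtain ⟨C, hC⟩ := (isCompact_Icc (a := (1 : ℝ))
    (b := Real.cosh (|θ| + |r|) + 1)).exists_bound_of_continuousOn
    (hB.mono Icc_subset_Ici_self)
  have hpos : ∀ᶠ ε in nhdsWithin (0 : ℝ) (Ioi 0), ε ∈ Ioo (0 : ℝ) 1 :=
    Ioo_mem_nhdsGT one_pos
  refine tendsto_integral_filter_of_dominated_convergence (fun _ => C) ?_ ?_
    (integrable_const _) ?_
  · filter_upwards [hpos] with ε hε
    refine (hB.comp_continuous (hcW.add continuous_const) fun ξ => ?_).aestronglyMeasurable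
    have := one_le_coshSide r θ (hmem ξ)
    have := hε.1
    simp only [mem_Ici, Pi.add_apply]
    linarith
  · filter_upwards [hpos] with ε hε
    refine Filter.Eventually.of_forall fun ξ => hC _ ⟨?_, ?_⟩
    · linarith [one_le_coshSide r θ (hmem ξ), hε.1]
    · linarith [coshSide_le_cosh_abs_add_abs r θ (hmem ξ), hε.2]
  · refine Filter.Eventually.of_forall fun ξ => ?_
    have h1 := one_le_coshSide r θ (hmem ξ)
    refine (hB _ h1).tendsto.comp (tendsto_nhdsWithin_iff.2 ⟨?_, ?_⟩)
    · have : Filter.Tendsto (fun ε : ℝ => coshSide r θ ⟪u, (ξ : E)⟫ + ε) (nhds 0)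
          (nhds (coshSide r θ ⟪u, (ξ : E)⟫ + 0)) := by
        exact (continuous_const.add continuous_id).tendsto _
      rw [add_zero] at this
      exact this.mono_left nhdsWithin_le_nhds
    · filter_upwards [hpos] with ε hε
      simp only [mem_Ici]
      linarith [hε.1]

/-- The shift moves the singular value w = 1 out of reach, so the mean is differentiable even across
θ = r, where the sphere passes through the diagonal. -/
theorem sphereMean_shift (h : IsSubharmonicProfile n B b b') (hn : 2 ≤ n)
    (hE : Module.finrank ℝ E = n) {u : E} (hu : ‖u‖ = 1) (r : ℝ) {ε : ℝ} (hε : 0 < ε) :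
    (∀ θ, HasDerivAt (sphereMean u (fun w => B (w + ε)) r)
      (sphereMeanDeriv u (fun w => b (w + ε)) r θ) θ) ∧
    MonotoneOn (fun θ => Real.sinh θ ^ (n - 1) * sphereMeanDeriv u (fun w => b (w + ε)) r θ)
      (Ici 0) := by
  have hW : ∀ θ ∈ (univ : Set ℝ), ∀ s ∈ Icc (-1 : ℝ) 1, 1 - ε < coshSide r θ s :=
    fun θ _ s hs => by linarith [one_le_coshSide r θ hs]
  have hB : ∀ w ∈ Ioi (1 - ε), HasDerivAt (fun w => B (w + ε)) (b (w + ε)) w := fun w hw =>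
    (h.hasDerivAt (w + ε) (by linarith [mem_Ioi.1 hw])).comp_add_const w ε
  have hb : ∀ w ∈ Ioi (1 - ε), HasDerivAt (fun w => b (w + ε)) (b' (w + ε)) w := fun w hw =>
    (h.hasDerivAt' (w + ε) (by linarith [mem_Ioi.1 hw])).comp_add_const w ε
  have hb'c : ContinuousOn (fun w => b' (w + ε)) (Ioi (1 - ε)) :=
    h.continuousOn'.comp (by fun_prop) fun w hw => by
      simp only [mem_Ioi] at hw ⊢
      linarith
  have hflux : ∀ θ, _ := fun θ => hasDerivAt_sphereMean_flux (hE ▸ hn) hu hb hb'c isOpen_univ hW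
    (mem_univ θ)
  rw [hE] at hflux
  refine ⟨fun θ => hasDerivAt_sphereMean hu hB
    (fun w hw => (hb w hw).continuousAt.continuousWithinAt) isOpen_univ hW (mem_univ θ), ?_⟩
  refine monotoneOn_of_deriv_nonneg (convex_Ici 0)
    (fun θ _ => (hflux θ).continuousAt.continuousWithinAt)
    (fun θ _ => (hflux θ).differentiableAt.differentiableWithinAt) fun θ hθ => ?_
  rw [(hflux θ).deriv]
  refine mul_nonneg (pow_nonneg (Real.sinh_nonneg_iff.2 (interior_subset hθ)) _)
    (integral_nonneg fun ξ => ?_)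
  exact h.shift_laplace_nonneg hn (one_le_coshSide r θ (inner_mem_Icc_of_sphere hu ξ)) hε

/-- Spherical means of a subharmonic profile are convex in the variable `-Φ`. -/
theorem sphereMean_slope_le (h : IsSubharmonicProfile n B b b') (hn : 2 ≤ n)
    (hE : Module.finrank ℝ E = n) {u : E} (hu : ‖u‖ = 1) (r : ℝ) {c : ℝ} {Φ : ℝ → ℝ}
    (hΦ : IsGreenProfile n c Φ) {x y z : ℝ} (hx : 0 < x) (hxy : x < y) (hyz : y < z) :
    (sphereMean u B r y - sphereMean u B r x) * (Φ y - Φ z)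
      ≤ (sphereMean u B r z - sphereMean u B r y) * (Φ x - Φ y) := by
  have ht := tendsto_sphereMean_shift h.continuousOn hu r
  -- The three-point inequality contains no derivative, so it survives ε → 0.
  refine le_of_tendsto_of_tendsto (((ht y).sub (ht x)).mul_const (Φ y - Φ z))
    (((ht z).sub (ht y)).mul_const (Φ x - Φ y)) ?_
  filter_upwards [self_mem_nhdsWithin] with ε hε
  obtain ⟨h1, h2⟩ := h.sphereMean_shift hn hE hu r hε
  exact hΦ.slope_le_of_flux (fun θ _ => h1 θ) (h2.mono Ioi_subset_Ici_self) hx hxy hyz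

/-- The flux of the shifted mean is increasing and vanishes at θ = 0, hence is nonnegative; then ε →
0. -/
theorem monotoneOn_sphereMean (h : IsSubharmonicProfile n B b b') (hn : 2 ≤ n)
    (hE : Module.finrank ℝ E = n) {u : E} (hu : ‖u‖ = 1) (r : ℝ) :
    MonotoneOn (sphereMean u B r) (Ici 0) := by
  intro x hx y hy hxy
  have ht := tendsto_sphereMean_shift h.continuousOn hu r
  refine le_of_tendsto_of_tendsto (ht x) (ht y) ?_
  filter_upwards [self_mem_nhdsWithin] with ε hε
  obtain ⟨h1, h2⟩ := h.sphereMean_shift hn hE hu r hε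
  refine monotoneOn_of_deriv_nonneg (convex_Ici 0)
    (fun θ _ => (h1 θ).continuousAt.continuousWithinAt)
    (fun θ _ => (h1 θ).differentiableAt.differentiableWithinAt) (fun θ hθ => ?_) hx hy hxy
  rw [interior_Ici] at hθ
  rw [(h1 θ).deriv]
  have h3 := h2 (mem_Ici.2 le_rfl) (Ioi_subset_Ici_self hθ) (le_of_lt hθ)
  simp only [Real.sinh_zero, zero_pow (by omega : n - 1 ≠ 0), zero_mul] at h3
  exact nonneg_of_mul_nonneg_right h3 (pow_pos (Real.sinh_pos_iff.2 hθ) _)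

end IsSubharmonicProfile

/-! ### Polar coordinates, distance and measurability. -/

section Geometry

open scoped RealInnerProductSpace

variable {n : ℕ}

/-- The measure `sinh^{n-1} θ dθ` on `(0, ∞)`. -/
noncomputable def radialVol (n : ℕ) : Measure ℝ :=
  (volume.restrict (Ioi (0 : ℝ))).withDensity (fun θ => ENNReal.ofReal (Real.sinh θ ^ (n - 1)))

theorem hypVol_eq (n : ℕ) : hypVol n
    = ((radialVol n).prod (volume : Measure (EuclideanSpace ℝ (Fin n))).toSphere).map hypPolar :=
  rfl

theorem continuous_hypPolar : Continuous (hypPolar (n := n)) := by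
  refine Continuous.subtype_mk (continuous_pi fun i => ?_) _
  refine Fin.cases ?_ (fun i => ?_) i
  · simp only [Fin.cons_zero]; fun_prop
  · simp only [Fin.cons_succ]; fun_prop

theorem continuous_hypGraph : Continuous (hypGraph (n := n)) := by
  refine Continuous.subtype_mk (continuous_pi fun i => ?_) _
  refine Fin.cases ?_ (fun i => ?_) i
  · simp only [Fin.cons_zero]; fun_prop
  · simp only [Fin.cons_succ]; fun_prop

theorem lorentz_hypPolar (p q : ℝ × Metric.sphere (0 : EuclideanSpace ℝ (Fin n)) 1) :
    lorentz (hypPolar p).1 (hypPolar q).1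
      = coshSide q.1 p.1 ⟪(p.2 : EuclideanSpace ℝ (Fin n)), q.2⟫ := by
  simp only [lorentz, hypPolar, Fin.cons_zero, Fin.cons_succ, coshSide, PiLp.inner_apply,
    Finset.mul_sum]
  congr 1
  refine Finset.sum_congr rfl fun i _ => ?_
  simp
  ring

theorem one_le_coe_zero (x : HypSpace n) : 1 ≤ x.1 0 := by
  rw [← hypGraph_hypCoord x, hypGraph_coe_zero, Real.one_le_sqrt]
  nlinarith [sq_nonneg ‖hypCoord x‖]

theorem hypDist_hypVertex (x : HypSpace n) : hypDist (hypVertex n) x = Real.arcosh (x.1 0) := by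
  rw [hypDist, lorentz_comm, lorentz_hypVertex_right]

theorem hypDist_hypVertex_nonneg (x : HypSpace n) : 0 ≤ hypDist (hypVertex n) x := by
  rw [hypDist_hypVertex]
  exact Real.arcosh_nonneg (one_le_coe_zero x)

theorem continuous_hypDist_hypVertex : Continuous (hypDist (hypVertex n)) := by
  have : hypDist (hypVertex n) = fun x => Real.arcosh (x.1 0) := funext hypDist_hypVertex
  rw [this]
  exact Real.continuousOn_arcosh.comp_continuous
    ((continuous_apply 0).comp continuous_subtype_val) one_le_coe_zero

theorem hypDist_hypVertex_hypPolar (p : ℝ × Metric.sphere (0 : EuclideanSpace ℝ (Fin n)) 1) :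
    hypDist (hypVertex n) (hypPolar p) = |p.1| := by
  have h : (hypPolar p).1 0 = Real.cosh |p.1| := by rw [Real.cosh_abs]; rfl
  rw [hypDist_hypVertex, h, Real.arcosh_cosh (abs_nonneg _)]

theorem hypCoord_hypPolar (p : ℝ × Metric.sphere (0 : EuclideanSpace ℝ (Fin n)) 1) :
    hypCoord (hypPolar p) = Real.sinh p.1 • (p.2 : EuclideanSpace ℝ (Fin n)) := by
  ext i
  simp [hypCoord, hypPolar]

theorem hypPolar_eq_hypGraph (p : ℝ × Metric.sphere (0 : EuclideanSpace ℝ (Fin n)) 1) :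
    hypPolar p = hypGraph (Real.sinh p.1 • (p.2 : EuclideanSpace ℝ (Fin n))) := by
  rw [← hypCoord_hypPolar, hypGraph_hypCoord]

theorem norm_hypCoord (x : HypSpace n) :
    ‖hypCoord x‖ = Real.sinh (hypDist (hypVertex n) x) := by
  have h1 : x.1 0 = √(1 + ‖hypCoord x‖ ^ 2) := by rw [← hypGraph_coe_zero, hypGraph_hypCoord]
  rw [hypDist_hypVertex, Real.sinh_arcosh (one_le_coe_zero x), h1, Real.sq_sqrt (by positivity),
    add_sub_cancel_left, Real.sqrt_sq (norm_nonneg _)]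

theorem exists_hypPolar_eq (hn : 2 ≤ n) (x : HypSpace n) :
    ∃ ξ : Metric.sphere (0 : EuclideanSpace ℝ (Fin n)) 1,
      hypPolar (hypDist (hypVertex n) x, ξ) = x := by
  have h := norm_hypCoord x
  rcases (hypDist_hypVertex_nonneg x).eq_or_lt with h0 | h0
  · rw [← h0] at h ⊢
    rw [Real.sinh_zero, norm_eq_zero] at h
    refine ⟨⟨EuclideanSpace.single ⟨0, by omega⟩ 1, by simp⟩, ?_⟩
    rw [hypPolar_eq_hypGraph, Real.sinh_zero, zero_smul, ← h, hypGraph_hypCoord]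
  · have hs : 0 < Real.sinh (hypDist (hypVertex n) x) := Real.sinh_pos_iff.2 h0
    refine ⟨⟨(Real.sinh (hypDist (hypVertex n) x))⁻¹ • hypCoord x, ?_⟩, ?_⟩
    · rw [mem_sphere_zero_iff_norm, norm_smul, norm_inv, Real.norm_of_nonneg hs.le, h,
        inv_mul_cancel₀ hs.ne']
    · rw [hypPolar_eq_hypGraph]
      simp only [smul_smul, mul_inv_cancel₀ hs.ne', one_smul, hypGraph_hypCoord]

theorem one_le_lorentz (hn : 2 ≤ n) (x y : HypSpace n) : 1 ≤ lorentz x.1 y.1 := by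
  obtain ⟨ξ, hξ⟩ := exists_hypPolar_eq hn x
  obtain ⟨η, hη⟩ := exists_hypPolar_eq hn y
  rw [← hξ, ← hη, lorentz_hypPolar]
  exact one_le_coshSide _ _ (inner_mem_Icc_of_sphere (norm_eq_of_mem_sphere ξ) η)

theorem hypDist_nonneg (hn : 2 ≤ n) (x y : HypSpace n) : 0 ≤ hypDist x y :=
  Real.arcosh_nonneg (one_le_lorentz hn x y)

theorem measurable_hypDist : Measurable (fun p : HypSpace n × HypSpace n => hypDist p.1 p.2) := by
  have h : Continuous (fun p : HypSpace n × HypSpace n => lorentz p.1.1 p.2.1) := by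
    have h1 : ∀ i, Continuous fun p : HypSpace n × HypSpace n => p.1.1 i := fun i =>
      (continuous_apply i).comp (continuous_subtype_val.comp continuous_fst)
    have h2 : ∀ i, Continuous fun p : HypSpace n × HypSpace n => p.2.1 i := fun i =>
      (continuous_apply i).comp (continuous_subtype_val.comp continuous_snd)
    exact ((h1 0).mul (h2 0)).sub (continuous_finsetSum _ fun i _ => (h1 _).mul (h2 _))
  have h2 : Measurable Real.arcosh := by
    unfold Real.arcosh; fun_prop
  exact h2.comp h.measurable

theorem IsGreenProfile.measurable_comp_hypDist (hn : 2 ≤ n) {c : ℝ} {Φ : ℝ → ℝ}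
    (h : IsGreenProfile n c Φ) :
    Measurable (fun p : HypSpace n × HypSpace n => Φ (hypDist p.1 p.2)) := by
  classical
  -- Continuity of Φ is known only on (0, ∞). Distances are nonnegative, so the constant value Φ 0
  -- elsewhere changes nothing.
  have h1 : Measurable ((Ioi (0 : ℝ)).piecewise Φ fun _ => Φ 0) :=
    h.continuousOn.measurable_piecewise continuousOn_const measurableSet_Ioi
  convert h1.comp measurable_hypDist using 1
  ext p
  simp only [Function.comp_apply]
  rcases (hypDist_nonneg hn p.1 p.2).eq_or_lt with h0 | h0
  · rw [← h0, piecewise_eq_of_notMem _ _ _ (by simp)]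
  · rw [piecewise_eq_of_mem _ _ _ (show hypDist p.1 p.2 ∈ Ioi 0 from h0)]

theorem measurable_comp_hypDist (hn : 2 ≤ n) {A : ℝ → ℝ} (hA : ContinuousOn A (Ici 0)) :
    Measurable (fun p : HypSpace n × HypSpace n => A (hypDist p.1 p.2)) := by
  have h1 : Continuous fun t : ℝ => A (max t 0) :=
    hA.comp_continuous (by fun_prop) fun t => le_max_right t 0
  convert h1.measurable.comp measurable_hypDist using 1
  ext p
  simp only [Function.comp_apply]
  rw [max_eq_left (hypDist_nonneg hn p.1 p.2)]

end Geometry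

theorem withDensity_map {α β : Type*} [MeasurableSpace α] [MeasurableSpace β] {μ : Measure α}
    {g : α → β} (hg : Measurable g) {f : β → ENNReal} (hf : Measurable f) :
    (μ.map g).withDensity f = (μ.withDensity (f ∘ g)).map g := by
  ext s hs
  rw [withDensity_apply _ hs, Measure.map_apply hg hs, withDensity_apply _ (hg hs),
    setLIntegral_map hs hf hg]
  rfl

/-! ### Disintegration of a radial density. -/

section RadialMeasure

variable {n : ℕ}

theorem ae_radialVol {p : ℝ → Prop} :
    (∀ᵐ r ∂(radialVol n), p r) ↔ ∀ᵐ r ∂(volume.restrict (Ioi (0 : ℝ))), p r := by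
  rw [radialVol, ae_withDensity_iff (by fun_prop)]
  constructor
  · intro h
    filter_upwards [h, ae_restrict_mem measurableSet_Ioi] with r h1 h2
    exact h1 (ENNReal.ofReal_pos.2 (pow_pos (Real.sinh_pos_iff.2 h2) _)).ne'
  · intro h
    filter_upwards [h] with r h1 _ using h1

theorem toSphere_volume_ne_zero (hn : 2 ≤ n) :
    (volume : Measure (EuclideanSpace ℝ (Fin n))).toSphere ≠ 0 := by
  have : Nontrivial (Fin n) := Fin.nontrivial_iff_two_le.2 hn
  exact Measure.toSphere_ne_zero _

/-- By Fubini almost every radius has almost every direction good; the sphere has positive measure,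
so one good direction exists, and one is enough for a property of the radius. -/
theorem ae_radialVol_of_ae_hypVol (hn : 2 ≤ n) {q : HypSpace n → Prop} {p : ℝ → Prop}
    (h : ∀ᵐ x ∂(hypVol n), q x) (hqp : ∀ r ξ, 0 < r → q (hypPolar (r, ξ)) → p r) :
    ∀ᵐ r ∂(radialVol n), p r := by
  rw [hypVol_eq] at h
  have h1 := Measure.ae_ae_of_ae_prod (ae_of_ae_map continuous_hypPolar.measurable.aemeasurable h)
  have h2 : ∀ᵐ r ∂(radialVol n), 0 < r := ae_radialVol.2 (ae_restrict_mem measurableSet_Ioi)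
  have : (ae (volume : Measure (EuclideanSpace ℝ (Fin n))).toSphere).NeBot :=
    ae_neBot.2 (toSphere_volume_ne_zero hn)
  filter_upwards [h1, h2] with r hr hr0
  obtain ⟨ξ, hξ⟩ := hr.exists
  exact hqp r ξ hr0 hξ

/-- The law of the distance to the vertex under a radial density, up to normalization. -/
structure IsRadialLaw (n : ℕ) (R : ℝ) (Φ : ℝ → ℝ) (ν : Measure (HypSpace n)) (κ : Measure ℝ) :
    Prop where
  finite : IsFiniteMeasure κ
  absolutelyContinuous : κ ≪ volume
  ae_pos : ∀ᵐ r ∂κ, 0 < r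
  ae_lt : ∀ᵐ r ∂κ, r < R
  integrable : Integrable Φ κ
  eq_map : ν = (κ.prod (volume : Measure (EuclideanSpace ℝ (Fin n))).toSphere).map hypPolar

theorem IsProbDensity.isProbabilityMeasure {ρ : HypSpace n → ℝ} (hρ : IsProbDensity ρ) :
    IsProbabilityMeasure (densityMeasure ρ) := by
  constructor
  rw [densityMeasure, withDensity_apply _ MeasurableSet.univ, Measure.restrict_univ,
    ← ofReal_integral_eq_lintegral_ofReal hρ.integrable hρ.nonneg, hρ.integral_eq_one,
    ENNReal.ofReal_one]

/-- The law is κ = f(r) sinh^{n-1} r dr, where f is the profile of ρ. Being multiplied by the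
unnormalized surface measure, κ need not have mass 1. -/
theorem exists_isRadialLaw (hn : 2 ≤ n) {c : ℝ} {Φ : ℝ → ℝ} (hΦ : IsGreenProfile n c Φ)
    {ρ : HypSpace n → ℝ} (hρ : IsProbDensity ρ)
    (hρ_bdd : ∃ C : ℝ, ∀ᵐ x ∂(hypVol n), ρ x ≤ C) (hρ_radial : IsRadial ρ)
    {R : ℝ} (hR : 0 < R)
    (hρ_supp : ∀ᵐ x ∂(hypVol n), x ∉ hypBall (hypVertex n) R → ρ x = 0) :
    ∃ κ, IsRadialLaw n R Φ (densityMeasure ρ) κ := by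
  obtain ⟨f, hf, hρf⟩ := hρ_radial
  obtain ⟨C, hC⟩ := hρ_bdd
  set σ := (volume : Measure (EuclideanSpace ℝ (Fin n))).toSphere with hσ
  set κ : Measure ℝ := (radialVol n).withDensity (fun r => ENNReal.ofReal (f r)) with hκ
  have hfm : Measurable fun r => ENNReal.ofReal (f r) := hf.ennreal_ofReal
  have hpos : ∀ᵐ r ∂(radialVol n), 0 < r := ae_radialVol.2 (ae_restrict_mem measurableSet_Ioi)
  have hfC : ∀ᵐ r ∂(radialVol n), f r ≤ C := by
    refine ae_radialVol_of_ae_hypVol hn (hρf.and hC) fun r ξ hr h => ?_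
    rw [h.1, hypDist_hypVertex_hypPolar, abs_of_pos hr] at h
    exact h.2
  have hfR : ∀ᵐ r ∂(radialVol n), R ≤ r → f r = 0 := by
    refine ae_radialVol_of_ae_hypVol hn (hρf.and hρ_supp) fun r ξ hr h hRr => ?_
    rw [h.1, hypDist_hypVertex_hypPolar, abs_of_pos hr] at h
    refine h.2 ?_
    rw [hypBall, mem_ofPred_eq, hypDist_hypVertex_hypPolar, abs_of_pos hr]
    exact not_lt.2 hRr
  have heq : densityMeasure ρ = (κ.prod σ).map hypPolar := by
    have hg : Measurable fun x : HypSpace n => ENNReal.ofReal (f (hypDist (hypVertex n) x)) :=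
      (hf.comp continuous_hypDist_hypVertex.measurable).ennreal_ofReal
    have h1 : densityMeasure ρ = (hypVol n).withDensity
        (fun x => ENNReal.ofReal (f (hypDist (hypVertex n) x))) :=
      withDensity_congr_ae (hρf.mono fun x hx => by simp only [hx])
    rw [h1, hypVol_eq, withDensity_map continuous_hypPolar.measurable hg, hκ,
      prod_withDensity_left hfm]
    congr 1
    refine withDensity_congr_ae ?_
    have h2 : ∀ᵐ p ∂((radialVol n).prod σ), 0 < p.1 :=
      Measure.quasiMeasurePreserving_fst.ae hpos
    filter_upwards [h2] with p hp
    simp only [Function.comp_apply, hypDist_hypVertex_hypPolar, abs_of_pos hp]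
  have := hρ.isProbabilityMeasure
  have hfin : IsFiniteMeasure κ := by
    constructor
    have h1 : (κ.prod σ) univ = 1 := by
      rw [← (measure_univ : densityMeasure ρ univ = 1), heq,
        Measure.map_apply continuous_hypPolar.measurable MeasurableSet.univ, preimage_univ]
    rw [← univ_prod_univ, Measure.prod_prod] at h1
    rw [lt_top_iff_ne_top]
    intro h2
    rw [h2, ENNReal.top_mul (Measure.measure_univ_ne_zero.2 (toSphere_volume_ne_zero hn))] at h1
    exact ENNReal.top_ne_one h1
  have hκpos : ∀ᵐ r ∂κ, 0 < r := (withDensity_absolutelyContinuous _ _).ae_le hpos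
  have hκR : ∀ᵐ r ∂κ, r < R := by
    rw [hκ, ae_withDensity_iff hfm]
    filter_upwards [hfR] with r hr hne
    by_contra! hle
    exact hne (by rw [hr hle, ENNReal.ofReal_zero])
  refine ⟨κ, hfin, (withDensity_absolutelyContinuous _ _).trans
    ((withDensity_absolutelyContinuous _ _).trans Measure.absolutelyContinuous_restrict),
    hκpos, hκR, ?_, heq⟩
  have hres : κ.restrict (Ioi 0) = κ := Measure.restrict_eq_self_of_ae_mem hκpos
  have hmeas : AEStronglyMeasurable Φ κ := by
    rw [← hres]
    exact hΦ.continuousOn.aestronglyMeasurable measurableSet_Ioi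
  refine ⟨hmeas, ?_⟩
  obtain ⟨D, hD⟩ := hΦ.exists_mul_sinh_pow_le hR
  -- The density is at most C, and Φ(r) sinh^{n-1} r at most D, on (0, R]; beyond R the density
  -- vanishes.
  have hle : ∫⁻ r, ‖Φ r‖ₑ ∂κ ≤ ∫⁻ r in Ioi (0 : ℝ),
      (Ioc 0 R).indicator (fun _ => ENNReal.ofReal C * ENNReal.ofReal D) r := by
    refine (lintegral_withDensity_le_lintegral_mul _ hfm _).trans ?_
    refine (lintegral_withDensity_le_lintegral_mul _ (by fun_prop) _).trans ?_
    refine lintegral_mono_ae ?_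
    filter_upwards [ae_radialVol.1 hfC, ae_radialVol.1 hfR, ae_restrict_mem measurableSet_Ioi]
      with r h1 h2 h3
    simp only [Pi.mul_apply]
    by_cases hrR : r ≤ R
    · rw [indicator_of_mem (show r ∈ Ioc 0 R from ⟨h3, hrR⟩),
        Real.enorm_of_nonneg (hΦ.nonneg r (le_of_lt h3))]
      calc _ = ENNReal.ofReal (f r) * (ENNReal.ofReal (Φ r)
            * ENNReal.ofReal (Real.sinh r ^ (n - 1))) := by ring
        _ ≤ _ := by
          rw [← ENNReal.ofReal_mul (hΦ.nonneg r (le_of_lt h3))]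
          exact mul_le_mul' (ENNReal.ofReal_le_ofReal h1)
            (ENNReal.ofReal_le_ofReal (hD r ⟨h3, hrR⟩))
    · rw [h2 (le_of_not_ge hrR)]
      simp
  refine hle.trans_lt ?_
  rw [lintegral_indicator_const measurableSet_Ioc]
  refine ENNReal.mul_lt_top (ENNReal.mul_lt_top ENNReal.ofReal_lt_top ENNReal.ofReal_lt_top) ?_
  exact (Measure.restrict_apply_le _ _).trans_lt measure_Ioc_lt_top

end RadialMeasure

/-! ### The potential of a radial measure. -/

section Potential

open scoped RealInnerProductSpace

variable {n : ℕ}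

theorem hypDist_le_add (hn : 2 ≤ n) (x y : HypSpace n) :
    hypDist x y ≤ hypDist (hypVertex n) x + hypDist (hypVertex n) y := by
  obtain ⟨ξ, hξ⟩ := exists_hypPolar_eq hn x
  obtain ⟨η, hη⟩ := exists_hypPolar_eq hn y
  have hx := hypDist_hypVertex_nonneg x
  have hy := hypDist_hypVertex_nonneg y
  set θ := hypDist (hypVertex n) x
  set r := hypDist (hypVertex n) y
  have hmem := inner_mem_Icc_of_sphere (norm_eq_of_mem_sphere ξ) η
  have h1 := coshSide_le_cosh_abs_add_abs r θ hmem
  rw [abs_of_nonneg hx, abs_of_nonneg hy] at h1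
  rw [← hξ, ← hη, hypDist, lorentz_hypPolar, ← Real.arcosh_cosh (add_nonneg hx hy)]
  exact (Real.arcosh_le_arcosh (by linarith [one_le_coshSide r θ hmem]) (Real.cosh_pos _)).2 h1

theorem hypDist_hypPolar (p q : ℝ × Metric.sphere (0 : EuclideanSpace ℝ (Fin n)) 1) :
    hypDist (hypPolar p) (hypPolar q)
      = Real.arcosh (coshSide q.1 p.1 ⟪(p.2 : EuclideanSpace ℝ (Fin n)), q.2⟫) := by
  rw [hypDist, lorentz_hypPolar]

namespace IsRadialLaw

variable {R : ℝ} {Φ : ℝ → ℝ} {ν : Measure (HypSpace n)} {κ : Measure ℝ}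

theorem ae_hypDist (h : IsRadialLaw n R Φ ν κ) {s : Set ℝ} (hs : MeasurableSet s)
    (hκ : ∀ᵐ r ∂κ, r ∈ s) : ∀ᵐ y ∂ν, hypDist (hypVertex n) y ∈ s := by
  have := h.finite
  rw [h.eq_map, ae_map_iff continuous_hypPolar.measurable.aemeasurable
    (continuous_hypDist_hypVertex.measurable hs)]
  filter_upwards [Measure.quasiMeasurePreserving_fst.ae (hκ.and h.ae_pos)] with p hp
  rw [hypDist_hypVertex_hypPolar, abs_of_pos hp.2]
  exact hp.1

theorem isFiniteMeasure (h : IsRadialLaw n R Φ ν κ) : IsFiniteMeasure ν := by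
  have := h.finite
  rw [h.eq_map]
  infer_instance

theorem integral_eq (h : IsRadialLaw n R Φ ν κ) {g : HypSpace n → ℝ} (hg : Integrable g ν) :
    Integrable (fun r => ∫ ξ, g (hypPolar (r, ξ))
      ∂(volume : Measure (EuclideanSpace ℝ (Fin n))).toSphere) κ ∧
    ∫ y, g y ∂ν = ∫ r, ∫ ξ, g (hypPolar (r, ξ))
      ∂(volume : Measure (EuclideanSpace ℝ (Fin n))).toSphere ∂κ := by
  have := h.finite
  have hg' := hg
  rw [h.eq_map] at hg'
  have hi := (integrable_map_measure hg'.aestronglyMeasurable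
    continuous_hypPolar.measurable.aemeasurable).1 hg'
  refine ⟨hi.integral_prod_left, ?_⟩
  rw [h.eq_map, integral_map continuous_hypPolar.measurable.aemeasurable
    hg'.aestronglyMeasurable]
  exact integral_prod _ hi

theorem exists_bound_comp_hypDist (h : IsRadialLaw n R Φ ν κ) (hn : 2 ≤ n) {A : ℝ → ℝ}
    (hA : ContinuousOn A (Ici 0)) (T : ℝ) :
    ∃ C, ∀ x, hypDist (hypVertex n) x ≤ T → ∀ᵐ y ∂ν, ‖A (hypDist x y)‖ ≤ C := by
  obtain ⟨C, hC⟩ := (isCompact_Icc (a := (0 : ℝ)) (b := T + R)).exists_bound_of_continuousOn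
    (hA.mono Icc_subset_Ici_self)
  refine ⟨C, fun x hx => ?_⟩
  filter_upwards [h.ae_hypDist measurableSet_Iio h.ae_lt] with y hy
  exact hC _ ⟨hypDist_nonneg hn x y, (hypDist_le_add hn x y).trans
    (add_le_add hx (le_of_lt hy))⟩

theorem integrable_comp_hypDist (h : IsRadialLaw n R Φ ν κ) (hn : 2 ≤ n) {A : ℝ → ℝ}
    (hA : ContinuousOn A (Ici 0)) (x : HypSpace n) :
    Integrable (fun y => A (hypDist x y)) ν := by
  have := h.isFiniteMeasure
  obtain ⟨C, hC⟩ := h.exists_bound_comp_hypDist hn hA (hypDist (hypVertex n) x)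
  exact Integrable.of_bound ((measurable_comp_hypDist hn hA).comp
    measurable_prodMk_left).aestronglyMeasurable C (hC x le_rfl)

/-- Rotation invariance replaces the direction of x by a fixed unit vector `e`, so that one profile
serves all x. -/
theorem integral_hypPolar_eq_sphereMean (F : ℝ → ℝ) {e : EuclideanSpace ℝ (Fin n)} (he : ‖e‖ = 1)
    (θ r : ℝ) (ξ : Metric.sphere (0 : EuclideanSpace ℝ (Fin n)) 1) :
    ∫ η, F (hypDist (hypPolar (θ, ξ)) (hypPolar (r, η)))
      ∂(volume : Measure (EuclideanSpace ℝ (Fin n))).toSphere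
      = sphereMean e (fun w => F (Real.arcosh w)) r θ := by
  simp only [hypDist_hypPolar, sphereMean]
  exact integral_toSphere_inner_eq (fun s => F (Real.arcosh (coshSide r θ s)))
    (by rw [norm_eq_of_mem_sphere, he])

/-- Newton's theorem is available only off the sphere r = θ; κ has no atoms, so that radius can be
ignored. -/
theorem ae_ne (h : IsRadialLaw n R Φ ν κ) (θ : ℝ) : ∀ᵐ r ∂κ, r ≠ θ := by
  refine h.absolutelyContinuous.ae_le ?_
  exact compl_mem_ae_iff.2 (measure_singleton θ)

theorem integrable_max (h : IsRadialLaw n R Φ ν κ) {c : ℝ} (hΦ : IsGreenProfile n c Φ) {θ : ℝ}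
    (hθ : 0 ≤ θ) :
    Integrable (fun r => Φ (max θ r)) κ ∧ ∫ r, Φ (max θ r) ∂κ ≤ ∫ r, Φ r ∂κ := by
  have hres : κ.restrict (Ioi 0) = κ := Measure.restrict_eq_self_of_ae_mem h.ae_pos
  have hle : ∀ r, 0 < r → Φ (max θ r) ≤ Φ r := fun r hr =>
    hΦ.strictAntiOn.antitoneOn hr (hr.trans_le (le_max_right θ r)) (le_max_right θ r)
  have hi : Integrable (fun r => Φ (max θ r)) κ := by
    refine h.integrable.mono' ?_ ?_
    · rw [← hres]
      exact (hΦ.continuousOn.comp (by fun_prop) fun r hr =>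
        (lt_of_lt_of_le hr (le_max_right θ r) : _)).aestronglyMeasurable measurableSet_Ioi
    · filter_upwards [h.ae_pos] with r hr
      rw [Real.norm_of_nonneg (hΦ.nonneg _ (hθ.trans (le_max_left _ _)))]
      exact hle r hr
  exact ⟨hi, integral_mono_ae hi h.integrable (h.ae_pos.mono hle)⟩

/-- The Green potential of a radial measure. -/
theorem integrable_green (h : IsRadialLaw n R Φ ν κ) (hn : 2 ≤ n) {c : ℝ}
    (hΦ : IsGreenProfile n c Φ) (x : HypSpace n) :
    Integrable (fun y => Φ (hypDist x y)) ν ∧ ∫ y, Φ (hypDist x y) ∂ν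
      = ∫ r, (volume : Measure (EuclideanSpace ℝ (Fin n))).toSphere.real univ
        * Φ (max (hypDist (hypVertex n) x) r) ∂κ := by
  have := h.finite
  obtain ⟨ξ, hξ⟩ := exists_hypPolar_eq hn x
  have hθ := hypDist_hypVertex_nonneg x
  set θ := hypDist (hypVertex n) x
  have hm : Measurable fun y => Φ (hypDist x y) :=
    (hΦ.measurable_comp_hypDist hn).comp measurable_prodMk_left
  have hu : ‖(ξ : EuclideanSpace ℝ (Fin n))‖ = 1 := norm_eq_of_mem_sphere ξ
  have hmean : ∀ r, 0 < r → r ≠ θ →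
      ∫ η, Φ (hypDist x (hypPolar (r, η)))
        ∂(volume : Measure (EuclideanSpace ℝ (Fin n))).toSphere
      = (volume : Measure (EuclideanSpace ℝ (Fin n))).toSphere.real univ * Φ (max θ r) := by
    intro r hr hne
    rw [← hξ, integral_hypPolar_eq_sphereMean Φ hu,
      hΦ.sphereMean_eq hn (by simp) hu hθ hr.le hne.symm]
  -- On each sphere r ≠ θ the integrand is continuous. Since Φ ≥ 0, Newton's theorem also computes
  -- the integral of its norm, which is then integrable in r.
  have hint : Integrable (fun y => Φ (hypDist x y)) ν := by
    rw [h.eq_map, integrable_map_measure hm.aestronglyMeasurable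
      continuous_hypPolar.measurable.aemeasurable,
      integrable_prod_iff (hm.comp continuous_hypPolar.measurable).aestronglyMeasurable]
    constructor
    · filter_upwards [h.ae_pos, h.ae_ne θ] with r hr hne
      refine Continuous.integrable_of_hasCompactSupport ?_ (HasCompactSupport.of_compactSpace _)
      simp only [Function.comp_apply]
      rw [← hξ]
      simp only [hypDist_hypPolar]
      have hlt : ∀ η : Metric.sphere (0 : EuclideanSpace ℝ (Fin n)) 1,
          1 < coshSide r θ ⟪(ξ : EuclideanSpace ℝ (Fin n)), η⟫ := fun η =>
        one_lt_coshSide (by rw [abs_of_nonneg hθ, abs_of_pos hr]; exact hne.symm)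
          (inner_mem_Icc_of_sphere hu η)
      have hc : Continuous fun η : Metric.sphere (0 : EuclideanSpace ℝ (Fin n)) 1 =>
          Real.arcosh (coshSide r θ ⟪(ξ : EuclideanSpace ℝ (Fin n)), η⟫) :=
        Real.continuousOn_arcosh.comp_continuous
          ((continuous_coshSide_inner _ r).comp (Continuous.prodMk_right θ))
          fun η => (hlt η).le
      exact hΦ.continuousOn.comp_continuous hc fun η => Real.arcosh_pos (hlt η)
    · refine ((h.integrable_max hΦ hθ).1.const_mul
        ((volume : Measure (EuclideanSpace ℝ (Fin n))).toSphere.real univ)).congr ?_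
      filter_upwards [h.ae_pos, h.ae_ne θ] with r hr hne
      rw [← hmean r hr hne]
      refine integral_congr_ae (Filter.Eventually.of_forall fun η => ?_)
      exact (Real.norm_of_nonneg (hΦ.nonneg _ (hypDist_nonneg hn _ _))).symm
  refine ⟨hint, ?_⟩
  rw [(h.integral_eq hint).2]
  refine integral_congr_ae ?_
  filter_upwards [h.ae_pos, h.ae_ne θ] with r hr hne using hmean r hr hne

theorem integral_comp_hypDist (h : IsRadialLaw n R Φ ν κ) (hn : 2 ≤ n) {A : ℝ → ℝ}
    (hA : ContinuousOn A (Ici 0)) {e : EuclideanSpace ℝ (Fin n)} (he : ‖e‖ = 1) {θ : ℝ}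
    (hθ : 0 ≤ θ) :
    Integrable (fun r => sphereMean e (fun w => A (Real.arcosh w)) r θ) κ ∧
    ∀ x, hypDist (hypVertex n) x = θ →
      ∫ y, A (hypDist x y) ∂ν = ∫ r, sphereMean e (fun w => A (Real.arcosh w)) r θ ∂κ := by
  have key : ∀ x, hypDist (hypVertex n) x = θ →
      Integrable (fun r => sphereMean e (fun w => A (Real.arcosh w)) r θ) κ ∧
      ∫ y, A (hypDist x y) ∂ν = ∫ r, sphereMean e (fun w => A (Real.arcosh w)) r θ ∂κ := by
    intro x hx
    obtain ⟨ξ, hξ⟩ := exists_hypPolar_eq hn x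
    have h2 := h.integral_eq (h.integrable_comp_hypDist hn hA x)
    rw [hx] at hξ
    rw [← hξ] at h2 ⊢
    simp only [integral_hypPolar_eq_sphereMean A he] at h2
    exact h2
  refine ⟨(key (hypPolar (θ, ⟨e, by simpa using he⟩)) ?_).1, fun x hx => (key x hx).2⟩
  rw [hypDist_hypVertex_hypPolar, abs_of_nonneg hθ]

/-- The interaction potential of a radial measure, as a function of the distance to the vertex. -/
noncomputable def radialPotential (κ : Measure ℝ) (Φ A : ℝ → ℝ) (e : EuclideanSpace ℝ (Fin n))
    (θ : ℝ) : ℝ :=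
  ∫ r, ((volume : Measure (EuclideanSpace ℝ (Fin n))).toSphere.real univ * Φ (max θ r)
    + sphereMean e (fun w => A (Real.arcosh w)) r θ) ∂κ

theorem integral_potential (h : IsRadialLaw n R (greenProfile n) ν κ) (hn : 2 ≤ n) {c : ℝ}
    (hΦ : IsGreenProfile n c (greenProfile n)) {A : ℝ → ℝ} (hA : ContinuousOn A (Ici 0))
    {e : EuclideanSpace ℝ (Fin n)} (he : ‖e‖ = 1) (x : HypSpace n) :
    Integrable (fun y => potential A x y) ν ∧ ∫ y, potential A x y ∂ν
      = radialPotential κ (greenProfile n) A e (hypDist (hypVertex n) x) := by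
  have h1 := h.integrable_green hn hΦ x
  have h2 := h.integrable_comp_hypDist hn hA x
  have hθ := hypDist_hypVertex_nonneg x
  obtain ⟨h3, h4⟩ := h.integral_comp_hypDist hn hA he hθ
  refine ⟨h1.1.add h2, ?_⟩
  simp only [potential, radialPotential]
  rw [integral_add h1.1 h2, h1.2, h4 x rfl,
    integral_add ((h.integrable_max hΦ hθ).1.const_mul _) h3]

/-- The Green part has inner integrals bounded uniformly in x by the total sphere measure times ∫ Φ
dκ, as Φ(max θ r) ≤ Φ(r); the A part is bounded on the support. -/
theorem integrable_potential_prod (h : IsRadialLaw n R (greenProfile n) ν κ) (hn : 2 ≤ n) {c : ℝ}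
    (hΦ : IsGreenProfile n c (greenProfile n)) {A : ℝ → ℝ} (hA : ContinuousOn A (Ici 0)) :
    Integrable (fun p : HypSpace n × HypSpace n => potential A p.1 p.2) (ν.prod ν) := by
  have := h.isFiniteMeasure
  have hm1 := hΦ.measurable_comp_hypDist hn
  have hm2 := measurable_comp_hypDist hn hA
  obtain ⟨C, hC⟩ := h.exists_bound_comp_hypDist hn hA R
  have hball := h.ae_hypDist measurableSet_Iio h.ae_lt
  refine Integrable.add ?_ ?_
  · rw [integrable_prod_iff hm1.aestronglyMeasurable]
    refine ⟨Filter.Eventually.of_forall fun x => (h.integrable_green hn hΦ x).1, ?_⟩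
    refine Integrable.of_bound hm1.stronglyMeasurable.norm.integral_prod_right.aestronglyMeasurable
      ((volume : Measure (EuclideanSpace ℝ (Fin n))).toSphere.real univ
        * ∫ r, greenProfile n r ∂κ) (Filter.Eventually.of_forall fun x => ?_)
    have e : ∀ y, ‖greenProfile n (hypDist x y)‖ = greenProfile n (hypDist x y) := fun y =>
      Real.norm_of_nonneg (hΦ.nonneg _ (hypDist_nonneg hn _ _))
    simp only [e]
    rw [Real.norm_of_nonneg (integral_nonneg fun y => hΦ.nonneg _ (hypDist_nonneg hn _ _)),
      (h.integrable_green hn hΦ x).2, integral_const_mul]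
    exact mul_le_mul_of_nonneg_left
      (h.integrable_max hΦ (hypDist_hypVertex_nonneg x)).2 measureReal_nonneg
  · refine Integrable.of_bound hm2.aestronglyMeasurable C ?_
    rw [Measure.ae_prod_iff_ae_ae (measurableSet_le hm2.norm measurable_const)]
    filter_upwards [hball] with x hx using hC x (le_of_lt hx)

end IsRadialLaw

theorem convPotential_eq {ρ : HypSpace n → ℝ} (hρ : IsProbDensity ρ)
    (K : HypSpace n → HypSpace n → ℝ) (x : HypSpace n) :
    (Integrable (fun y => K x y * ρ y) (hypVol n) ↔ Integrable (K x) (densityMeasure ρ)) ∧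
    convPotential K ρ x = ∫ y, K x y ∂(densityMeasure ρ) := by
  have hm : AEMeasurable (fun x => ENNReal.ofReal (ρ x)) (hypVol n) :=
    hρ.integrable.aemeasurable.ennreal_ofReal
  have hlt : ∀ᵐ x ∂(hypVol n), ENNReal.ofReal (ρ x) < ⊤ :=
    Filter.Eventually.of_forall fun _ => ENNReal.ofReal_lt_top
  have e : (fun y => K x y * ρ y) =ᵐ[hypVol n] fun y => (ENNReal.ofReal (ρ y)).toReal • K x y := by
    filter_upwards [hρ.nonneg] with y hy
    rw [ENNReal.toReal_ofReal hy, smul_eq_mul, mul_comm]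
  rw [densityMeasure, integrable_withDensity_iff_integrable_smul₀' hm hlt,
    integral_withDensity_eq_integral_toReal_smul₀ hm hlt]
  exact ⟨integrable_congr e, integral_congr_ae e⟩

end Potential

/-! ### Critical points of functions convex in −Φ. -/

namespace IsGreenProfile

open Filter Topology

variable {n : ℕ} {c : ℝ} {Φ L : ℝ → ℝ}

/-- Divide the three-point inequality by y − a and let y ↓ a: as L'(a) = 0 and Φ'(a) < 0, what
remains is 0 ≤ (L z − L a) |Φ'(a)|. -/
theorem le_of_critical_left (hΦ : IsGreenProfile n c Φ) {a z : ℝ} (ha : 0 < a) (haz : a < z)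
    (hL : HasDerivAt L 0 a)
    (hs : ∀ y ∈ Ioo a z, (L y - L a) * (Φ y - Φ z) ≤ (L z - L y) * (Φ a - Φ y)) :
    L a ≤ L z := by
  have hs0 : 0 < c / Real.sinh a ^ (n - 1) := div_pos hΦ.pos (pow_pos (Real.sinh_pos_iff.2 ha) _)
  have hΦa := hΦ.hasDerivAt a ha
  have hmono : 𝓝[>] a ≤ 𝓝[≠] a := nhdsWithin_mono _ fun y hy => ne_of_gt hy
  have t1 := (hasDerivAt_iff_tendsto_slope.1 hL).mono_left hmono
  have t2 := (hasDerivAt_iff_tendsto_slope.1 hΦa).mono_left hmono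
  have t3 : Tendsto L (𝓝[>] a) (𝓝 (L a)) := hL.continuousAt.tendsto.mono_left nhdsWithin_le_nhds
  have t4 : Tendsto Φ (𝓝[>] a) (𝓝 (Φ a)) := hΦa.continuousAt.tendsto.mono_left nhdsWithin_le_nhds
  have hlim := le_of_tendsto_of_tendsto (t1.mul (t4.sub_const (Φ z)))
    ((t3.const_sub (L z)).mul t2.neg) (by
      filter_upwards [Ioo_mem_nhdsGT haz] with y hy
      have hya : 0 < y - a := sub_pos.2 hy.1
      have h := div_le_div_of_nonneg_right (hs y hy) hya.le
      rw [slope_def_field, slope_def_field]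
      calc _ = (L y - L a) * (Φ y - Φ z) / (y - a) := by ring
        _ ≤ _ := h
        _ = _ := by ring)
  rw [zero_mul, neg_neg] at hlim
  exact sub_nonneg.1 (nonneg_of_mul_nonneg_left hlim hs0)

/-- The mirror argument, dividing by b − y as y ↑ b. -/
theorem le_of_critical_right (hΦ : IsGreenProfile n c Φ) {x b : ℝ} (hx : 0 < x) (hxb : x < b)
    (hL : HasDerivAt L 0 b)
    (hs : ∀ y ∈ Ioo x b, (L y - L x) * (Φ y - Φ b) ≤ (L b - L y) * (Φ x - Φ y)) :
    L b ≤ L x := by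
  have hb := hx.trans hxb
  have hs0 : 0 < c / Real.sinh b ^ (n - 1) := div_pos hΦ.pos (pow_pos (Real.sinh_pos_iff.2 hb) _)
  have hΦb := hΦ.hasDerivAt b hb
  have hmono : 𝓝[<] b ≤ 𝓝[≠] b := nhdsWithin_mono _ fun y hy => ne_of_lt hy
  have t1 := (hasDerivAt_iff_tendsto_slope.1 hL).mono_left hmono
  have t2 := (hasDerivAt_iff_tendsto_slope.1 hΦb).mono_left hmono
  have t3 : Tendsto L (𝓝[<] b) (𝓝 (L b)) := hL.continuousAt.tendsto.mono_left nhdsWithin_le_nhds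
  have t4 : Tendsto Φ (𝓝[<] b) (𝓝 (Φ b)) := hΦb.continuousAt.tendsto.mono_left nhdsWithin_le_nhds
  have hlim := le_of_tendsto_of_tendsto ((t3.sub_const (L x)).mul t2.neg)
    (t1.mul (t4.const_sub (Φ x))) (by
      filter_upwards [Ioo_mem_nhdsLT hxb] with y hy
      have hyb : 0 < b - y := sub_pos.2 hy.2
      have h := div_le_div_of_nonneg_right (hs y hy) hyb.le
      have hyb' : y - b ≠ 0 := by linarith
      rw [slope_def_field, slope_def_field]
      calc _ = (L y - L x) * (Φ y - Φ b) / (b - y) := by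
            rw [← neg_sub y b, div_neg]; ring
        _ ≤ _ := h
        _ = _ := by rw [← neg_sub y b, div_neg]; ring)
  rw [zero_mul, neg_neg] at hlim
  by_contra! hlt
  have := mul_pos (sub_pos.2 hlt) hs0
  linarith

/-- A function that is critical on a compact set `S` and subharmonic on its gaps is constant on `S`
and attains its minimum there. -/
theorem exists_const_of_gaps (hΦ : IsGreenProfile n c Φ) {S : Set ℝ} (hS : IsCompact S) {s₀ : ℝ}
    (hs₀ : s₀ ∈ S) (hs₀pos : 0 < s₀) (hL : ∀ s ∈ S, 0 < s → HasDerivAt L 0 s)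
    (hgap : ∀ a b, 0 ≤ a → Disjoint S (Ioo a b) → ∀ x y z, 0 < x → a ≤ x → x < y → y < z →
      z ≤ b → (L y - L x) * (Φ y - Φ z) ≤ (L z - L y) * (Φ x - Φ y))
    (hfirst : ∀ b, Disjoint S (Ioo 0 b) → MonotoneOn L (Ioc 0 b)) :
    ∃ l, (∀ s ∈ S, 0 < s → L s = l) ∧ ∀ x, 0 < x → l ≤ L x := by
  obtain ⟨m, hmS, hm⟩ := hS.exists_isGreatest ⟨s₀, hs₀⟩
  have hmpos : 0 < m := hs₀pos.trans_le (hm hs₀)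
  have hcrit : ∀ x, 0 < x → x ≤ m → HasDerivAt L 0 x := by
    intro x hx hxm
    by_cases hxS : x ∈ S
    · exact hL x hxS hx
    -- The gap (a, b) around x: b is the next point of S, a the previous one, with 0 as a substitute
    -- when there is none.
    obtain ⟨b, ⟨hbS, hxb⟩, hb⟩ := (hS.inter_right isClosed_Ici).exists_isLeast
      (⟨m, hmS, hxm⟩ : (S ∩ Ici x).Nonempty)
    obtain ⟨a, ha, ha'⟩ := ((hS.inter_right (isClosed_Icc (a := 0) (b := x))).insert
      0).exists_isGreatest ⟨0, mem_insert _ _⟩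
    have hxb' : x < b := lt_of_le_of_ne hxb fun h => hxS (h ▸ hbS)
    have ha0 : 0 ≤ a := ha' (mem_insert _ _)
    have hax : a < x := by
      rcases ha with rfl | ha
      · exact hx
      · exact lt_of_le_of_ne ha.2.2 fun h => hxS (h ▸ ha.1)
    have hdisj : Disjoint S (Ioo a b) := by
      rw [Set.disjoint_left]
      intro t htS ht
      rcases le_total t x with h | h
      · exact not_le.2 ht.1 (ha' (mem_insert_of_mem _ ⟨htS, ha0.trans ht.1.le, h⟩))
      · exact not_le.2 ht.2 (hb ⟨htS, h⟩)
    have hbpos := hx.trans hxb'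
    have hLb := hL b hbS hbpos
    have hright : ∀ t, 0 < t → a ≤ t → t < b → L b ≤ L t := fun t ht hat htb =>
      hΦ.le_of_critical_right ht htb hLb fun y hy =>
        hgap a b ha0 hdisj t y b ht hat hy.1 hy.2 le_rfl
    have hconst : ∀ t ∈ Ioo a b, L t = L b := by
      intro t ht
      refine le_antisymm ?_ (hright t (ha0.trans_lt ht.1) ht.1.le ht.2)
      -- When a = 0, whether or not 0 lies in S, no critical left end is available and monotonicity
      -- replaces it.
      rcases ha with rfl | ha
      · exact hfirst b hdisj ⟨ht.1, ht.2.le⟩ ⟨hbpos, le_rfl⟩ ht.2.le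
      rcases ha0.eq_or_lt with h0 | h0
      · subst h0
        exact hfirst b hdisj ⟨ht.1, ht.2.le⟩ ⟨hbpos, le_rfl⟩ ht.2.le
      have hab : L a = L b := le_antisymm
        (hΦ.le_of_critical_left h0 (hax.trans hxb') (hL a ha.1 h0) fun y hy =>
          hgap a b ha0 hdisj a y b h0 le_rfl hy.1 hy.2 le_rfl)
        (hright a h0 le_rfl (hax.trans hxb'))
      -- With equal end values L a = L b, convexity puts L t below them.
      have h1 := hgap a b ha0 hdisj a t b h0 le_rfl ht.1 ht.2 le_rfl
      have h2 : 0 < Φ a - Φ b := sub_pos.2 (hΦ.strictAntiOn h0 hbpos (hax.trans hxb'))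
      rw [hab] at h1
      by_contra! hlt
      have := mul_pos (sub_pos.2 hlt) h2
      linarith
    refine (hasDerivAt_const x (L b)).congr_of_eventuallyEq ?_
    filter_upwards [Ioo_mem_nhds hax hxb'] with t ht using hconst t ht
  have hconst : ∀ x, 0 < x → x ≤ m → L x = L m := by
    intro x hx hxm
    rcases hxm.eq_or_lt with rfl | hlt
    · rfl
    obtain ⟨t, ht, ht2⟩ := exists_hasDerivAt_eq_slope L (fun _ => 0) hlt
      (fun y hy => (hcrit y (hx.trans_le hy.1) hy.2).continuousAt.continuousWithinAt)
      (fun y hy => hcrit y (hx.trans hy.1) hy.2.le)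
    have : m - x ≠ 0 := by linarith
    rw [eq_comm, div_eq_zero_iff, or_iff_left this] at ht2
    linarith
  refine ⟨L m, fun s hs hs0 => hconst s hs0 (hm hs), fun x hx => ?_⟩
  rcases le_or_gt x m with h | h
  · exact (hconst x hx h).ge
  · refine hΦ.le_of_critical_left hmpos h (hL m hmS hmpos) fun y hy =>
      hgap m x hmpos.le ?_ m y x hmpos le_rfl hy.1 hy.2 le_rfl
    rw [Set.disjoint_left]
    exact fun t htS ht => not_le.2 ht.1 (hm htS)

end IsGreenProfile

/-! ### Gaps of the support and conclusion. -/

section Final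

variable {n : ℕ}

namespace IsRadialLaw

variable {R : ℝ} {Φ : ℝ → ℝ} {ν : Measure (HypSpace n)} {κ : Measure ℝ}

theorem ae_notMem_of_disjoint_support (h : IsRadialLaw n R Φ ν κ) (hn : 2 ≤ n) {a b : ℝ}
    (ha : 0 ≤ a) (hd : Disjoint (hypDist (hypVertex n) '' ν.support) (Ioo a b)) :
    ∀ᵐ r ∂κ, r ∉ Ioo a b := by
  have := h.finite
  have h0 : ν (hypDist (hypVertex n) ⁻¹' Ioo a b) = 0 := by
    refine measure_mono_null (t := ν.supportᶜ) (fun x hx hx' => ?_) ν.measure_compl_support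
    exact Set.disjoint_left.1 hd ⟨x, hx', rfl⟩ hx
  rw [h.eq_map, Measure.map_apply continuous_hypPolar.measurable
    (continuous_hypDist_hypVertex.measurable measurableSet_Ioo)] at h0
  have h1 : (κ.prod (volume : Measure (EuclideanSpace ℝ (Fin n))).toSphere)
      (Ioo a b ×ˢ univ) = 0 := by
    refine measure_mono_null (fun p hp => ?_) h0
    rw [mem_preimage, mem_preimage, hypDist_hypVertex_hypPolar, abs_of_pos (ha.trans_lt hp.1.1)]
    exact hp.1
  rw [Measure.prod_prod, mul_eq_zero] at h1
  exact compl_mem_ae_iff.2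
    (h1.resolve_right (Measure.measure_univ_ne_zero.2 (toSphere_volume_ne_zero hn)))

/-- In the global chart the support is closed and contained in the ball of radius sinh R. -/
theorem isCompact_image_support (h : IsRadialLaw n R Φ ν κ) :
    IsCompact (hypDist (hypVertex n) '' ν.support) := by
  have hsub : ν.support ⊆ hypDist (hypVertex n) ⁻¹' Iic R := by
    refine Measure.support_subset_of_isClosed
      (isClosed_Iic.preimage continuous_hypDist_hypVertex) ?_
    filter_upwards [h.ae_hypDist measurableSet_Iio h.ae_lt] with y hy
    exact le_of_lt (mem_Iio.1 hy)
  have himg : ν.support = hypGraph '' (hypGraph ⁻¹' ν.support) := by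
    rw [image_preimage_eq]
    exact fun x => ⟨_, hypGraph_hypCoord x⟩
  have hc : IsCompact (hypGraph ⁻¹' ν.support) := by
    refine (isCompact_closedBall (0 : EuclideanSpace ℝ (Fin n)) (Real.sinh R)).of_isClosed_subset
      (Measure.isClosed_support.preimage continuous_hypGraph) fun u hu => ?_
    rw [mem_closedBall_zero_iff, ← hypCoord_hypGraph u, norm_hypCoord]
    exact Real.sinh_le_sinh.2 (hsub hu)
  rw [himg]
  exact (hc.image continuous_hypGraph).image continuous_hypDist_hypVertex

theorem integrable_profile (h : IsRadialLaw n R Φ ν κ) (hn : 2 ≤ n) {c : ℝ}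
    (hΦ : IsGreenProfile n c Φ) {A : ℝ → ℝ} (hA : ContinuousOn A (Ici 0))
    {e : EuclideanSpace ℝ (Fin n)} (he : ‖e‖ = 1) {θ : ℝ} (hθ : 0 ≤ θ) :
    Integrable (fun r => (volume : Measure (EuclideanSpace ℝ (Fin n))).toSphere.real univ
      * Φ (max θ r) + sphereMean e (fun w => A (Real.arcosh w)) r θ) κ :=
  ((h.integrable_max hΦ hθ).1.const_mul _).add (h.integral_comp_hypDist hn hA he hθ).1

/-- For r outside the gap, Φ(max θ r) is, on the gap, either Φ(θ), affine in −Φ, or constant. In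
both cases the Green part gives equality, and the inequality comes from the mean of A. -/
theorem radialPotential_slope_le (h : IsRadialLaw n R Φ ν κ) (hn : 2 ≤ n) {c : ℝ}
    (hΦ : IsGreenProfile n c Φ) {A b b' : ℝ → ℝ} (hA : ContinuousOn A (Ici 0))
    (hB : IsSubharmonicProfile n (fun w => A (Real.arcosh w)) b b')
    {e : EuclideanSpace ℝ (Fin n)} (he : ‖e‖ = 1) {p q : ℝ} (hκ : ∀ᵐ r ∂κ, r ∉ Ioo p q)
    {x y z : ℝ} (hx : 0 < x) (hpx : p ≤ x) (hxy : x < y) (hyz : y < z) (hzq : z ≤ q) :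
    (radialPotential κ Φ A e y - radialPotential κ Φ A e x) * (Φ y - Φ z)
      ≤ (radialPotential κ Φ A e z - radialPotential κ Φ A e y) * (Φ x - Φ y) := by
  have hy := hx.trans hxy
  have hz := hy.trans hyz
  have ix := h.integrable_profile hn hΦ hA he hx.le
  have iy := h.integrable_profile hn hΦ hA he hy.le
  have iz := h.integrable_profile hn hΦ hA he hz.le
  simp only [radialPotential]
  rw [← integral_sub iy ix, ← integral_sub iz iy, ← integral_mul_const, ← integral_mul_const]
  refine integral_mono_ae ((iy.sub ix).mul_const _) ((iz.sub iy).mul_const _) ?_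
  filter_upwards [hκ] with r hr
  have hmean := hB.sphereMean_slope_le hn (by simp) he r hΦ hx hxy hyz
  have hcase : r ≤ p ∨ q ≤ r := by
    by_contra! hlt
    exact hr hlt
  rcases hcase with hrp | hqr
  · rw [max_eq_left (by linarith : r ≤ x), max_eq_left (by linarith : r ≤ y),
      max_eq_left (by linarith : r ≤ z)]
    linarith
  · rw [max_eq_right (by linarith : x ≤ r), max_eq_right (by linarith : y ≤ r),
      max_eq_right (by linarith : z ≤ r)]
    linarith

/-- With no mass at radii in (0, q) the Green part is constant on (0, q], and the means of A
increase. -/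
theorem monotoneOn_radialPotential (h : IsRadialLaw n R Φ ν κ) (hn : 2 ≤ n) {c : ℝ}
    (hΦ : IsGreenProfile n c Φ) {A b b' : ℝ → ℝ} (hA : ContinuousOn A (Ici 0))
    (hB : IsSubharmonicProfile n (fun w => A (Real.arcosh w)) b b')
    {e : EuclideanSpace ℝ (Fin n)} (he : ‖e‖ = 1) {q : ℝ} (hκ : ∀ᵐ r ∂κ, r ∉ Ioo 0 q) :
    MonotoneOn (radialPotential κ Φ A e) (Ioc 0 q) := by
  intro x hx y hy hxy
  refine integral_mono_ae (h.integrable_profile hn hΦ hA he hx.1.le)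
    (h.integrable_profile hn hΦ hA he hy.1.le) ?_
  filter_upwards [hκ, h.ae_pos] with r hr hr0
  have hmean := hB.monotoneOn_sphereMean hn (by simp) he r (mem_Ici.2 hx.1.le)
    (mem_Ici.2 hy.1.le) hxy
  have hqr : q ≤ r := by
    by_contra! hlt
    exact hr ⟨hr0, hlt⟩
  rw [max_eq_right (hx.2.trans hqr), max_eq_right (hy.2.trans hqr)]
  linarith

theorem exists_pos_mem_support (h : IsRadialLaw n R Φ ν κ) (hν : ν ≠ 0) :
    ∃ s ∈ hypDist (hypVertex n) '' ν.support, 0 < s := by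
  have : (ae ν).NeBot := ae_neBot.2 hν
  obtain ⟨x, hx, hx0⟩ := (Filter.Eventually.and (ν.support_mem_ae)
    (h.ae_hypDist measurableSet_Ioi h.ae_pos)).exists
  exact ⟨_, ⟨x, hx, rfl⟩, hx0⟩

end IsRadialLaw

theorem ae_hypVol_hypDist_pos (n : ℕ) : ∀ᵐ x ∂(hypVol n), 0 < hypDist (hypVertex n) x := by
  rw [hypVol_eq]
  refine (ae_map_iff continuous_hypPolar.measurable.aemeasurable
    (continuous_hypDist_hypVertex.measurable measurableSet_Ioi)).2 ?_
  have hpos : ∀ᵐ r ∂(radialVol n), 0 < r := ae_radialVol.2 (ae_restrict_mem measurableSet_Ioi)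
  filter_upwards [Measure.quasiMeasurePreserving_fst.ae hpos] with p hp
  rw [mem_Ioi, hypDist_hypVertex_hypPolar]
  exact abs_pos.2 hp.ne'

/-- A radial function with zero differential at a point has a radial profile with zero derivative. -/
theorem hasDerivAt_profile_of_hasFDerivAt (hn : 2 ≤ n) {Λ : HypSpace n → ℝ} {L : ℝ → ℝ}
    (hL : ∀ x, Λ x = L (hypDist (hypVertex n) x)) {x : HypSpace n}
    (hx : 0 < hypDist (hypVertex n) x)
    (hd : HasFDerivAt (fun u => Λ (hypGraph u)) (0 : EuclideanSpace ℝ (Fin n) →L[ℝ] ℝ)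
      (hypCoord x)) : HasDerivAt L 0 (hypDist (hypVertex n) x) := by
  obtain ⟨ξ, hξ⟩ := exists_hypPolar_eq hn x
  set θ := hypDist (hypVertex n) x
  rw [← hξ, hypCoord_hypPolar] at hd
  have hpath := (Real.hasDerivAt_sinh θ).smul_const (ξ : EuclideanSpace ℝ (Fin n))
  have hcomp := hd.comp_hasDerivAt θ hpath
  rw [zero_apply] at hcomp
  refine hcomp.congr_of_eventuallyEq ?_
  filter_upwards [Ioi_mem_nhds hx] with t ht
  have ht0 : 0 < t := ht
  rw [Function.comp_apply, ← hypPolar_eq_hypGraph (t, ξ), hL, hypDist_hypVertex_hypPolar,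
    abs_of_pos ht0]

end Final

theorem proposition3p2 (n : ℕ) (hn : 2 ≤ n) (A : ℝ → ℝ)
    (hA_cont : ContinuousOn A (Set.Ici 0)) (hA_smooth : ContDiffOn ℝ 2 A (Set.Ioi 0))
    (hA_laplace : ∀ x y : HypSpace n, x ≠ y →
      0 ≤ laplaceBeltrami (fun z => A (hypDist z y)) x)
    (ρ : HypSpace n → ℝ) (hρ : IsProbDensity ρ)
    (hρ_bdd : ∃ C : ℝ, ∀ᵐ x ∂(hypVol n), ρ x ≤ C)
    (hρ_radial : IsRadial ρ)
    (R : ℝ) (hR : 0 < R)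
    (hρ_supp : ∀ᵐ x ∂(hypVol n), x ∉ hypBall (hypVertex n) R → ρ x = 0)
    (hρ_eq : IsEquilibrium (potential A) ρ) :
    -- the integrals that define `Λ` and `E` converge
    (∀ x : HypSpace n, MeasureTheory.Integrable (fun y => potential A x y * ρ y) (hypVol n)) ∧
    MeasureTheory.Integrable (fun p : HypSpace n × HypSpace n => potential A p.1 p.2)
      ((densityMeasure ρ).prod (densityMeasure ρ)) ∧
    -- the two Euler-Lagrange conditions, with `λ = 2 E[ρ]`
    (∀ᵐ x ∂(hypVol n), x ∈ densitySupport ρ →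
      convPotential (potential A) ρ x
        = 2 * interactionEnergy (potential A) (densityMeasure ρ)) ∧
    (∀ᵐ x ∂(hypVol n), x ∉ densitySupport ρ →
      2 * interactionEnergy (potential A) (densityMeasure ρ)
        ≤ convPotential (potential A) ρ x) := by
  obtain ⟨c, hΦ⟩ := isGreenProfile_greenProfile hn
  obtain ⟨κ, hκ⟩ := exists_isRadialLaw hn hΦ hρ hρ_bdd hρ_radial hR hρ_supp
  obtain ⟨b, b', hB⟩ := isSubharmonicProfile_comp_arcosh hn hA_cont hA_smooth hA_laplace
  have := hρ.isProbabilityMeasure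
  set ν := densityMeasure ρ with hν
  obtain ⟨e, he⟩ : ∃ e : EuclideanSpace ℝ (Fin n), ‖e‖ = 1 :=
    ⟨EuclideanSpace.single ⟨0, by omega⟩ 1, by simp⟩
  set L := IsRadialLaw.radialPotential κ (greenProfile n) A e with hL
  have hpot := hκ.integral_potential hn hΦ hA_cont he
  have hconv : ∀ x, convPotential (potential A) ρ x = L (hypDist (hypVertex n) x) := fun x => by
    rw [(convPotential_eq hρ _ x).2, (hpot x).2]
  have hprod := hκ.integrable_potential_prod hn hΦ hA_cont
  obtain ⟨s₀, hs₀, hs₀pos⟩ := hκ.exists_pos_mem_support (IsProbabilityMeasure.ne_zero ν)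
  obtain ⟨l, hl, hle⟩ := hΦ.exists_const_of_gaps (L := L) hκ.isCompact_image_support hs₀ hs₀pos
    (by
      rintro _ ⟨x, hx, rfl⟩ hpos
      exact hasDerivAt_profile_of_hasFDerivAt hn hconv hpos (hρ_eq x hx))
    (fun p q hp hd x y z hx hpx hxy hyz hzq => hκ.radialPotential_slope_le hn hΦ hA_cont hB he
      (hκ.ae_notMem_of_disjoint_support hn hp hd) hx hpx hxy hyz hzq)
    (fun q hd => hκ.monotoneOn_radialPotential hn hΦ hA_cont hB he
      (hκ.ae_notMem_of_disjoint_support hn le_rfl hd))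
  -- By Fubini 2E is the ν-average of Λ, which equals l at ν-almost every point, and ν has mass 1.
  have henergy : 2 * interactionEnergy (potential A) ν = l := by
    have h1 : ∫ x, ∫ y, potential A x y ∂ν ∂ν = ∫ _, l ∂ν := by
      refine integral_congr_ae ?_
      filter_upwards [ν.support_mem_ae, hκ.ae_hypDist measurableSet_Ioi hκ.ae_pos] with x hx hx0
      rw [(hpot x).2]
      exact hl _ ⟨x, hx, rfl⟩ hx0
    rw [interactionEnergy, integral_prod _ hprod, h1, integral_const, probReal_univ, one_smul]
    ring
  refine ⟨fun x => (convPotential_eq hρ _ x).1.2 (hpot x).1, hprod, ?_, ?_⟩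
  · filter_upwards [ae_hypVol_hypDist_pos n] with x hx0 hx
    rw [henergy, hconv]
    exact hl _ ⟨x, hx, rfl⟩ hx0
  · filter_upwards [ae_hypVol_hypDist_pos n] with x hx0 _
    rw [henergy, hconv]
    exact hle _ hx0
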